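/- Let $\mathbb{K}$ be a field, $V$ a finite-dimensional $\mathbb{K}$-vector space, $S=\mathrm{Sym}(V^*)$, and let $\mathrm{Der}_{\mathbb{K}}(S)$ be the $S$-module of $\mathbb{K}$-linear derivations of $S$ to itself. A (central) arrangement $\mathcal{A}$ in $V$ is a finite set of linear hyperplanes of $V$; for $H\in\mathcal{A}$ let $\alpha_H\in V^*$ be a linear form with kernel $H$. For a multiplicity $m:\mathcal{A}\to\mathbb{Z}_{>0}$ put $$D(\mathcal{A},m)=\{\theta\in\mathrm{Der}_{\mathbb{K}}(S)\mid \theta(\alpha_H)\in S\cdot\alpha_H^{m(H)}\text{ for all }H\in\mathcal{A}\}.$$ The arrangement $\mathcal{A}$ is called totally free if $D(\mathcal{A},m)$ is a free $S$-module for every multiplicity $m:\mathcal{A}\to\mathbb{Z}_{>0}$. Let $\mathcal{A}$ be a totally free arrangement in $V$. Then: (1) every subarrangement $\mathcal{B}\subseteq\mathcal{A}$ is a totally free arrangement in $V$ (in particular, so is every deletion $\mathcal{A}\setminus\{H_0\}$, $H_0\in\mathcal{A}$); (2) for every $H_0\in\mathcal{A}$, the restriction $\{H_0\cap H\mid H\in\mathcal{A}\setminus\{H_0\}\}$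 is a totally free arrangement in the vector space $H_0$. -/

import Mathlib

/-- A central arrangement of hyperplanes in the `K`-vector space `V`: a finite collection of
linear hyperplanes (maximal proper linear subspaces). -/
structure CentralArrangement (K V : Type*) [Field K] [AddCommGroup V] [Module K V] where
  hyperplanes : Set (Submodule K V)
  finite : hyperplanes.Finite
  isCoatom : ∀ H ∈ hyperplanes, IsCoatom H

namespace CentralArrangement

/-- The symmetric algebra `S = Sym(V*)` of the dual space. -/
abbrev CoordRing (K V : Type*) [Field K] [AddCommGroup V] [Module K V] : Type _ :=
  SymmetricAlgebra K (Module.Dual K V)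

/-- A linear form `α ∈ V*`, viewed as an element of `S = Sym(V*)`. -/
abbrev linForm {K V : Type*} [Field K] [AddCommGroup V] [Module K V]
    (α : Module.Dual K V) : CoordRing K V :=
  SymmetricAlgebra.ι K (Module.Dual K V) α

section

variable {K V : Type*} [Field K] [AddCommGroup V] [Module K V]

/-- The logarithmic derivation module `D(A, m)`: the `K`-linear derivations `θ` of `S` with
`θ(α_H) ∈ S · α_H ^ m(H)` for all `H ∈ A`. The defining form `α_H` of `H` is unique up to a nonzero
scalar and the condition does not depend on the scalar, so it is imposed on every defining form. -/
def logDer (A : CentralArrangement K V) (m : A.hyperplanes → ℕ+) :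
    Submodule (CoordRing K V) (Derivation K (CoordRing K V) (CoordRing K V)) where
  carrier := {θ | ∀ (H : A.hyperplanes) (α : Module.Dual K V), LinearMap.ker α = H.1 →
    θ (linForm α) ∈ Ideal.span {linForm α ^ (m H : ℕ)}}
  zero_mem' := fun H α _ => by simp
  add_mem' := fun {θ η} hθ hη H α h => by
    rw [Derivation.add_apply]
    exact Ideal.add_mem _ (hθ H α h) (hη H α h)
  smul_mem' := fun s θ hθ H α h => by
    rw [Derivation.smul_apply, smul_eq_mul]
    exact Ideal.mul_mem_left _ s (hθ H α h)

/-- The multiplicity `m` on `A` is free: `D(A, m)` is a free `S`-module. -/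
def IsFreeMultiplicity (A : CentralArrangement K V) (m : A.hyperplanes → ℕ+) : Prop :=
  Module.Free (CoordRing K V) (A.logDer m)

/-- `A` is totally free: every multiplicity `m : A → ℤ_{>0}` is free. -/
def IsTotallyFree (A : CentralArrangement K V) : Prop :=
  ∀ m : A.hyperplanes → ℕ+, A.IsFreeMultiplicity m

/-- `B` is a subarrangement of `A`. -/
def IsSubarrangement (B A : CentralArrangement K V) : Prop :=
  B.hyperplanes ⊆ A.hyperplanes

/-- The deletion `A' = A \ {H₀}`. -/
def deletion (A : CentralArrangement K V) (H₀ : Submodule K V) : CentralArrangement K V where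
  hyperplanes := A.hyperplanes \ {H₀}
  finite := A.finite.subset Set.sdiff_subset
  isCoatom := fun H hH => A.isCoatom H hH.1

theorem isCoatom_comap_subtype {H₀ H : Submodule K V} (h₀ : IsCoatom H₀) (h : IsCoatom H)
    (hne : H ≠ H₀) : IsCoatom (H.comap H₀.subtype) := by
  have hle : ¬ H₀ ≤ H := fun hle => hne ((h₀.le_iff_eq h.1).1 hle)
  refine ⟨fun htop => hle (Submodule.comap_subtype_eq_top.1 htop), fun Y hY => ?_⟩
  have hmap : (Y.map H₀.subtype) ≤ H₀ := Submodule.map_subtype_le H₀ Y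
  obtain ⟨y, hyY, hyH⟩ := SetLike.exists_of_lt hY
  have hsup : H ⊔ Y.map H₀.subtype = ⊤ := by
    apply h.2
    refine lt_of_le_of_ne le_sup_left fun heq => hyH ?_
    change (y : V) ∈ H
    rw [heq]
    exact Submodule.mem_sup_right (Submodule.mem_map_of_mem hyY)
  rw [eq_top_iff]
  intro x _
  have hx : (x : V) ∈ H ⊔ Y.map H₀.subtype := hsup ▸ Submodule.mem_top
  obtain ⟨a, ha, b, hb, hab⟩ := Submodule.mem_sup.1 hx
  obtain ⟨b', hb', rfl⟩ := hb
  have hxb : x - b' ∈ Y := hY.le (by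
    change (x : V) - (b' : V) ∈ H
    rw [← hab]
    simpa using ha)
  simpa using Y.add_mem hxb hb'

/-- The restriction `A'' = {H₀ ∩ H | H ∈ A'}` to a hyperplane `H₀ ∈ A`, an arrangement in the
vector space `H₀`; here `H.comap H₀.subtype` is `H₀ ∩ H` as a subspace of `H₀`. -/
def restriction (A : CentralArrangement K V) (H₀ : Submodule K V) (h₀ : H₀ ∈ A.hyperplanes) :
    CentralArrangement K H₀ where
  hyperplanes := (fun H : Submodule K V => H.comap H₀.subtype) '' (A.deletion H₀).hyperplanes
  finite := (A.deletion H₀).finite.image _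
  isCoatom := by
    rintro _ ⟨H, hH, rfl⟩
    exact isCoatom_comap_subtype (A.isCoatom H₀ h₀) (A.isCoatom H hH.1) hH.2

end

end CentralArrangement

/-! Total freeness is equivalent to a condition on circuits (`HasSmallCircuits`): no defining form
is a combination, with all coefficients nonzero, of three or more independent defining forms. This
condition visibly passes to subarrangements and, by lifting forms from H₀ to V, to restrictions, so
the equivalence gives the theorem.

Totally free implies small circuits (`not_free_of_circuit`). Suppose φ = ∑ aᵢxᵢ is a circuit with n
≥ 3 terms. Give each xᵢ multiplicity N, φ a huge multiplicity k, and the remaining forms total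
multiplicity at most r < N. Freeness would yield independent homogeneous elements whose degrees sum
to at most k + nN + r (one half of Saito's criterion, `exists_homogeneous_of_basis`). One of them
has degree at least k; the others have degree below k, hence annihilate φ, and at least n - 1 of
these are nonzero on some xᵢ. For such θ the relation ∑ aᵢθ(xᵢ) = 0 with xᵢ^N ∣ θ(xᵢ) forces degree
at least 2N. So 2(n - 1)N ≤ nN + r, which is absurd.

Small circuits imply totally free. In a basis of V* containing a maximal independent set of defining
forms, every form involves at most two variables, and the pairs that occur form a matching
(`exists_matching`): the arrangement is a product of pieces of rank at most two. Raising one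
multiplicity at a time, `free_polyLogDer_of_matching` keeps an injective parametrization of the
derivation module; each step is a linear congruence in two unknowns, solved by Bézout in K[T]. -/

open MvPolynomial

/-! ### Linear forms and logarithmic derivations in coordinates. -/

/-- The linear polynomial `∑ aᵢ Xᵢ`. -/
noncomputable def linPoly {ι K : Type*} [Fintype ι] [Field K] (a : ι → K) : MvPolynomial ι K :=
  ∑ i, C (a i) * X i

/-- The logarithmic derivations along the linear polynomials `linPoly (a h)` with multiplicities
`m h`, given by their coefficient vectors. -/
def polyLogDer {ι K η : Type*} [Fintype ι] [Field K] (a : η → ι → K) (m : η → ℕ) :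
    Submodule (MvPolynomial ι K) (ι → MvPolynomial ι K) where
  carrier := {f | ∀ h, linPoly (a h) ^ m h ∣ ∑ i, C (a h i) * f i}
  zero_mem' := fun h => by simp
  add_mem' := fun {f g} hf hg h => by
    simpa [mul_add, Finset.sum_add_distrib] using dvd_add (hf h) (hg h)
  smul_mem' := fun s f hf h => by
    have := (hf h).mul_left s
    rw [Finset.mul_sum] at this
    simpa [mul_left_comm] using this

/-- Algebra homomorphisms agreeing on the variables modulo `p` agree modulo `p`. -/
theorem dvd_aeval_sub_aeval {ι K A : Type*} [Field K] [CommRing A] [Algebra K A] (p : A) (f g : ι → A)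
    (h : ∀ i, p ∣ f i - g i) (s : MvPolynomial ι K) : p ∣ aeval f s - aeval g s := by
  have key : (Ideal.Quotient.mkₐ K (Ideal.span {p})).comp (aeval f) =
      (Ideal.Quotient.mkₐ K (Ideal.span {p})).comp (aeval g) := by
    ext i
    simpa [Ideal.Quotient.eq, Ideal.mem_span_singleton] using h i
  rw [← Ideal.mem_span_singleton, ← Ideal.Quotient.eq]
  exact DFunLike.congr_fun key s

section LinearForms

variable {ι K : Type*} [Fintype ι] [Field K]

theorem mem_polyLogDer {η : Type*} {a : η → ι → K} {m : η → ℕ} {f : ι → MvPolynomial ι K} :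
    f ∈ polyLogDer a m ↔ ∀ h, linPoly (a h) ^ m h ∣ ∑ i, C (a h i) * f i := Iff.rfl

theorem linPoly_isHomogeneous (a : ι → K) : (linPoly a).IsHomogeneous 1 :=
  IsHomogeneous.sum _ _ _ fun _ _ => isHomogeneous_C_mul_X _ _

theorem aeval_linPoly {A : Type*} [CommRing A] [Algebra K A] (f : ι → A) (a : ι → K) :
    aeval f (linPoly a) = ∑ i, a i • f i := by
  simp [linPoly, Algebra.smul_def]

theorem coeff_linPoly [DecidableEq ι] (a : ι → K) (i : ι) :
    (linPoly a).coeff (Finsupp.single i 1) = a i := by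
  simp [linPoly, coeff_sum, coeff_C_mul, coeff_X, Finsupp.single_left_inj]

theorem linPoly_injective : Function.Injective (linPoly : (ι → K) → MvPolynomial ι K) := by
  classical
  intro a b h
  ext i
  rw [← coeff_linPoly a, h, coeff_linPoly]

theorem linPoly_zero : linPoly (0 : ι → K) = 0 := by simp [linPoly]

theorem linPoly_ne_zero {a : ι → K} (ha : a ≠ 0) : linPoly a ≠ 0 := fun h =>
  ha (linPoly_injective (h.trans linPoly_zero.symm))

theorem linPoly_single [DecidableEq ι] (i : ι) : linPoly (Pi.single i (1 : K)) = X i := by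
  rw [linPoly, Finset.sum_eq_single i] <;> simp +contextual

/-- Elimination of the variable `Xᵢ` by means of the equation `linPoly a = 0`. -/
noncomputable def elimVar [DecidableEq ι] (a : ι → K) (i : ι) (j : ι) : MvPolynomial ι K :=
  linPoly (Pi.single j 1 - (if j = i then (a i)⁻¹ • a else 0))

theorem linPoly_sub (a b : ι → K) : linPoly (a - b) = linPoly a - linPoly b := by
  simp [linPoly, sub_mul, Finset.sum_sub_distrib]

theorem linPoly_smul (c : K) (a : ι → K) : linPoly (c • a) = C c * linPoly a := by
  simp [linPoly, Finset.mul_sum, mul_assoc]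

theorem aeval_elimVar_linPoly [DecidableEq ι] (a : ι → K) (i : ι) (b : ι → K) :
    aeval (elimVar a i) (linPoly b) = linPoly (b - (b i / a i) • a) := by
  rw [aeval_linPoly]
  simp only [elimVar, linPoly_sub, smul_sub, Finset.sum_sub_distrib, linPoly_single]
  congr 1
  · simp [linPoly, smul_eq_C_mul]
  · rw [Finset.sum_eq_single i]
    · simp only [if_true, linPoly_smul, smul_eq_C_mul, div_eq_mul_inv, map_mul]
      ring
    · intro j _ hj
      simp [hj, linPoly_zero]
    · simp

theorem dvd_sub_aeval_elimVar [DecidableEq ι] (a : ι → K) (i : ι) (s : MvPolynomial ι K) :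
    linPoly a ∣ s - aeval (elimVar a i) s := by
  have := dvd_aeval_sub_aeval (linPoly a) X (elimVar a i) (fun j => ?_) s
  · simpa using this
  · rw [elimVar, linPoly_sub, linPoly_single, sub_sub_cancel]
    split_ifs
    · rw [linPoly_smul]; exact Dvd.intro_left _ rfl
    · simp [linPoly_zero]

/-- The substitution is the identity modulo `linPoly a` and kills `linPoly a`, so its kernel is
exactly the ideal generated by that form. Having values in a domain, it makes the form prime. -/
theorem aeval_elimVar_eq_zero_iff [DecidableEq ι] {a : ι → K} {i : ι} (hi : a i ≠ 0)
    (s : MvPolynomial ι K) : aeval (elimVar a i) s = 0 ↔ linPoly a ∣ s := by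
  constructor
  · intro h
    have := dvd_sub_aeval_elimVar a i s
    rwa [h, sub_zero] at this
  · rintro ⟨t, rfl⟩
    rw [map_mul, aeval_elimVar_linPoly, div_self hi]
    simp [linPoly_zero]

theorem linPoly_prime {a : ι → K} (ha : a ≠ 0) : Prime (linPoly a) := by
  classical
  obtain ⟨i, hi⟩ := Function.ne_iff.1 ha
  refine ⟨linPoly_ne_zero ha, fun hu => ?_, fun s t h => ?_⟩
  · have := (aeval_elimVar_eq_zero_iff hi 1).2 hu.dvd
    simp at this
  · simpa only [← aeval_elimVar_eq_zero_iff hi, map_mul, mul_eq_zero] using h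

theorem linPoly_dvd_linPoly {a b : ι → K} (ha : a ≠ 0) (h : linPoly a ∣ linPoly b) :
    ∃ c : K, b = c • a := by
  classical
  obtain ⟨i, hi⟩ := Function.ne_iff.1 ha
  rw [← aeval_elimVar_eq_zero_iff hi, aeval_elimVar_linPoly, ← linPoly_zero] at h
  exact ⟨_, sub_eq_zero.1 (linPoly_injective h)⟩

end LinearForms

/-! ### Half of Saito's criterion: degree bounds from freeness. -/

section Divisibility

/-- A divisor of a product of prime powers splits along the factors; the exponent at each prime is
then bounded locally, by a multiple of δ in which that prime occurs exactly `m h` times. -/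
theorem dvd_prod_pow_of_forall_dvd {R η : Type*} [CommRing R] [IsDomain R]
    [UniqueFactorizationMonoid R] (p : η → R) (m : η → ℕ) (M : ℕ) (hp : ∀ h, Prime (p h))
    (s : Finset η) : ∀ δ : R, δ ∣ ∏ h ∈ s, p h ^ M →
      (∀ h ∈ s, ∃ G, ¬ p h ∣ G ∧ δ ∣ p h ^ m h * G) → δ ∣ ∏ h ∈ s, p h ^ m h := by
  classical
  induction s using Finset.induction with
  | empty => intro δ h _; simpa using h
  | insert h s hs ih =>
    intro δ hδ hG
    rw [Finset.prod_insert hs] at hδ ⊢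
    obtain ⟨δ₁, δ₂, h₁, h₂, rfl⟩ := exists_dvd_and_dvd_of_dvd_mul hδ
    refine mul_dvd_mul ?_ (ih δ₂ h₂ fun h' hh' => ?_)
    · obtain ⟨c, -, hc⟩ := (dvd_prime_pow (hp h) M).1 h₁
      obtain ⟨G, hpG, hdG⟩ := hG h (Finset.mem_insert_self _ _)
      rw [hc.dvd_iff_dvd_left]
      exact (hp h).pow_dvd_of_dvd_mul_right c hpG
        ((hc.symm.dvd.trans (dvd_mul_right _ _)).trans hdG)
    · obtain ⟨G, hpG, hdG⟩ := hG h' (Finset.mem_insert_of_mem hh')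
      exact ⟨G, hpG, (dvd_mul_left _ _).trans hdG⟩

/-- Expanding the family in the basis is a matrix product. Consequently the determinant of a basis
divides that of every family in the module. -/
theorem det_eq_basis_det_mul {R ι : Type*} [CommRing R] [Fintype ι] [DecidableEq ι]
    {D : Submodule R (ι → R)} (b : Module.Basis ι R D) (f : ι → D) :
    (Matrix.of fun i j => (f i : ι → R) j).det =
      b.det f * (Matrix.of fun i j => (b i : ι → R) j).det := by
  rw [b.det_apply, ← Matrix.det_transpose (b.toMatrix f), ← Matrix.det_mul]
  congr 1
  ext i j
  have := congrArg (fun x : D => (x : ι → R) j) (b.sum_repr (f i))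
  simp only [Submodule.coe_sum, Submodule.coe_smul, Finset.sum_apply, Pi.smul_apply,
    smul_eq_mul] at this
  simp [Matrix.mul_apply, Module.Basis.toMatrix_apply, this]

end Divisibility

section Degree

variable {ι K : Type*} [Field K]

/-- At a monomial of least degree in δ, only the constant term of `u` contributes to the product, so
that monomial survives and its degree must be `s`. -/
theorem le_totalDegree_of_isHomogeneous_mul {u δ : MvPolynomial ι K} {s : ℕ}
    (hu : constantCoeff u ≠ 0) (hδ : δ ≠ 0) (h : (u * δ).IsHomogeneous s) :
    s ≤ δ.totalDegree := by
  classical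
  obtain ⟨t, ht, hmin⟩ := Finset.exists_min_image δ.support Finsupp.degree
    (support_nonempty.2 hδ)
  have hc : (u * δ).coeff t = constantCoeff u * δ.coeff t := by
    rw [coeff_mul, Finset.sum_eq_single (0, t)]
    · rfl
    · rintro ⟨p, q⟩ hpq hne
      have hpq' : p + q = t := Finset.HasAntidiagonal.mem_antidiagonal.1 hpq
      have hq : q ∉ δ.support := fun hq => by
        have h1 := hmin q hq
        rw [← hpq', map_add] at h1
        have hp : p = 0 := by
          rw [← Finsupp.degree_eq_zero_iff]; omega
        subst hp
        simp at hpq'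
        exact hne (by simp [hpq'])
      simp [notMem_support_iff.1 hq]
    · simp
  have hne : (u * δ).coeff t ≠ 0 := by
    rw [hc]; exact mul_ne_zero hu (mem_support_iff.1 ht)
  have hdeg : t.degree = s := by
    by_contra hd
    exact hne (h.coeff_eq_zero hd)
  rw [← hdeg]
  exact le_totalDegree ht

theorem sum_homogeneousComponent_of_le {φ : MvPolynomial ι K} {M : ℕ} (h : φ.totalDegree ≤ M) :
    ∑ d ∈ Finset.range (M + 1), homogeneousComponent d φ = φ := by
  conv_rhs => rw [← sum_homogeneousComponent φ]
  refine (Finset.sum_subset (Finset.range_mono (by omega)) fun d _ hd => ?_).symm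
  exact homogeneousComponent_eq_zero _ _ (by simpa using hd)

-- The principal ideal of a homogeneous element is a homogeneous ideal.
attribute [local instance] MvPolynomial.gradedAlgebra in
theorem IsHomogeneous.dvd_homogeneousComponent {p f : MvPolynomial ι K} {n : ℕ}
    (hp : p.IsHomogeneous n) (h : p ∣ f) (d : ℕ) : p ∣ homogeneousComponent d f := by
  rw [← Ideal.mem_span_singleton] at h ⊢
  refine homogeneousComponent_mem_of_mem (Ideal.homogeneous_span _ _ ?_) h d
  rintro x rfl
  exact ⟨n, hp⟩

theorem homogeneousComponent_mem_polyLogDer [Fintype ι] {η : Type*} {a : η → ι → K} {m : η → ℕ}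
    {f : ι → MvPolynomial ι K} (hf : f ∈ polyLogDer a m) (d : ℕ) :
    (fun i => homogeneousComponent d (f i)) ∈ polyLogDer a m := by
  intro h
  have := IsHomogeneous.dvd_homogeneousComponent ((linPoly_isHomogeneous (a h)).pow (m h)) (hf h) d
  simpa [map_sum] using this

end Degree

section Saito

variable {ι K η : Type*} [Fintype ι] [Field K] [Fintype η]
  {a : η → ι → K} {m : η → ℕ}

theorem totalDegree_prod_linPoly_le :
    (∏ h, linPoly (a h) ^ m h).totalDegree ≤ ∑ h, m h := by
  refine IsHomogeneous.totalDegree_le (IsHomogeneous.prod _ _ _ fun h _ => ?_)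
  simpa using (linPoly_isHomogeneous (a h)).pow (m h)

/-- A free logarithmic derivation module has rank `|ι|`. -/
theorem nonempty_basis_polyLogDer (ha : ∀ h, a h ≠ 0)
    (hfree : Module.Free (MvPolynomial ι K) (polyLogDer a m)) :
    Nonempty (Module.Basis ι (MvPolynomial ι K) (polyLogDer a m)) := by
  have hP : ∏ h, linPoly (a h) ^ m h ≠ 0 :=
    Finset.prod_ne_zero_iff.2 fun h _ => pow_ne_zero _ (linPoly_ne_zero (ha h))
  -- Multiplication by the defining polynomial embeds the full free module into the logarithmic one,
  -- which bounds the rank from below.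
  have hmem : ∀ f : ι → MvPolynomial ι K, (∏ h, linPoly (a h) ^ m h) • f ∈ polyLogDer a m := by
    intro f h
    simp only [Pi.smul_apply, smul_eq_mul]
    refine Finset.dvd_sum fun j _ => Dvd.dvd.mul_left (Dvd.dvd.mul_right ?_ _) _
    exact Finset.dvd_prod_of_mem (fun h => linPoly (a h) ^ m h) (Finset.mem_univ h)
  let φ : (ι → MvPolynomial ι K) →ₗ[MvPolynomial ι K] polyLogDer a m :=
    LinearMap.codRestrict _ (LinearMap.lsmul _ _ (∏ h, linPoly (a h) ^ m h)) hmem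
  have hφ : Function.Injective φ := by
    intro f g hfg
    have h1 : (∏ h, linPoly (a h) ^ m h) • f = (∏ h, linPoly (a h) ^ m h) • g :=
      congrArg Subtype.val hfg
    exact smul_right_injective _ hP h1
  have hle := LinearMap.finrank_le_finrank_of_injective hφ
  have hge := (polyLogDer a m).finrank_le
  rw [Module.finrank_fintype_fun_eq_card] at hle hge
  exact ⟨(Module.finBasisOfFinrankEq _ _ (le_antisymm hge hle)).reindex
    (Fintype.equivFin ι).symm⟩

variable [DecidableEq ι]

/-- The determinant of a basis of the logarithmic derivation module divides the defining
polynomial of the multiarrangement. -/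
theorem basis_det_dvd_prod (ha : ∀ h, a h ≠ 0)
    (hne : ∀ h h', linPoly (a h) ∣ linPoly (a h') → h = h')
    (b : Module.Basis ι (MvPolynomial ι K) (polyLogDer a m)) :
    (Matrix.of fun i j => (b i : ι → MvPolynomial ι K) j).det ∣ ∏ h, linPoly (a h) ^ m h := by
  classical
  set δ := (Matrix.of fun i j => (b i : ι → MvPolynomial ι K) j).det
  have hdvd : ∀ f : ι → ι → MvPolynomial ι K, (∀ i, f i ∈ polyLogDer a m) →
      δ ∣ (Matrix.of f).det := fun f hf =>
    Dvd.intro_left _ (det_eq_basis_det_mul b fun i => ⟨f i, hf i⟩).symm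
  set M := (∑ h, m h) * Fintype.card ι
  refine dvd_prod_pow_of_forall_dvd (fun h => linPoly (a h)) m M
    (fun h => linPoly_prime (ha h)) _ δ ?_ fun h _ => ?_
  -- Test family: the defining polynomial times the standard basis. It shows that no primes other
  -- than the forms divide δ.
  · refine (hdvd (fun i => (∏ h, linPoly (a h) ^ m h) • (Pi.single i 1)) fun i h => ?_).trans ?_
    · simp only [Pi.smul_apply, smul_eq_mul]
      refine Finset.dvd_sum fun j _ => Dvd.dvd.mul_left (Dvd.dvd.mul_right ?_ _) _
      exact Finset.dvd_prod_of_mem (fun h => linPoly (a h) ^ m h) (Finset.mem_univ h)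
    · have : (Matrix.of fun i => (∏ h, linPoly (a h) ^ m h) • (Pi.single i 1)) =
          (∏ h, linPoly (a h) ^ m h) • (1 : Matrix ι ι (MvPolynomial ι K)) := by
        ext i j : 2
        simp [Matrix.one_apply, Pi.single_apply, eq_comm]
      rw [this, Matrix.det_smul, Matrix.det_one, mul_one, ← Finset.prod_pow]
      refine Finset.prod_dvd_prod_of_dvd _ _ fun h _ => ?_
      rw [← pow_mul]
      exact pow_dvd_pow _ (Nat.mul_le_mul_right _
        (Finset.single_le_sum (fun _ _ => Nat.zero_le _) (Finset.mem_univ h)))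
  · obtain ⟨i, hi⟩ := Function.ne_iff.1 (ha h)
    set Q := ∏ h' ∈ Finset.univ.erase h, linPoly (a h') ^ m h' with hQ
    have hLQ : ¬ linPoly (a h) ∣ Q := by
      intro hd
      obtain ⟨h', hh', hd⟩ := (linPoly_prime (ha h)).exists_mem_finset_dvd hd
      exact (Finset.mem_erase.1 hh').1 (hne _ _ ((linPoly_prime (ha h)).dvd_of_dvd_pow hd)).symm
    refine ⟨Q ^ Fintype.card ι, fun hd => hLQ ((linPoly_prime (ha h)).dvd_of_dvd_pow hd), ?_⟩
    -- Test family adapted to `h`: for `k ≠ i` the vector e_k - (a_k / a_i) e_i annihilates the form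
    -- `h`, and e_i is multiplied by its `m h`-th power. The factor `Q` takes care of all other
    -- forms and is prime to `linPoly (a h)`.
    let c : ι → MvPolynomial ι K := fun k => if k = i then 0 else - C (a h k / a h i)
    let w : ι → MvPolynomial ι K := fun k => if k = i then linPoly (a h) ^ m h else 1
    let T : Matrix ι ι (MvPolynomial ι K) :=
      1 + Matrix.replicateCol Unit c * Matrix.replicateRow Unit (Pi.single i (1 : MvPolynomial ι K))
    have hT : T.det = 1 := by
      rw [Matrix.det_one_add_replicateCol_mul_replicateRow]
      simp [c]
    have hw : ∏ k, w k = linPoly (a h) ^ m h := by simp [w]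
    have hdet : (Q • (Matrix.diagonal w * T)).det = linPoly (a h) ^ m h * Q ^ Fintype.card ι := by
      rw [Matrix.det_smul, Matrix.det_mul, Matrix.det_diagonal, hT, hw, mul_one, mul_comm]
    rw [← hdet]
    refine hdvd _ fun k h' => ?_
    have hTe : ∀ j, T k j = (if k = j then 1 else 0) + c k * if j = i then 1 else 0 := fun j => by
      simp only [T, Matrix.add_apply, Matrix.one_apply, Matrix.mul_apply]
      simp [Pi.single_apply]
    have hentry : ∀ j, (Q • (Matrix.diagonal w * T)) k j =
        Q * (w k * ((if k = j then 1 else 0) + c k * if j = i then 1 else 0)) := fun j => by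
      rw [Matrix.smul_apply, Matrix.diagonal_mul, hTe, smul_eq_mul]
    have hval : ∑ j, C (a h' j) * (Q • (Matrix.diagonal w * T)) k j =
        Q * (w k * (C (a h' k) + c k * C (a h' i))) := by
      simp only [hentry, mul_add, mul_ite, mul_one, mul_zero, Finset.sum_add_distrib,
        Finset.sum_ite_eq, Finset.sum_ite_eq', Finset.mem_univ, if_true]
      ring
    change _ ∣ ∑ j, C (a h' j) * (Q • (Matrix.diagonal w * T)) k j
    rw [hval]
    by_cases hh : h' = h
    · subst hh
      by_cases hk : k = i
      · simp only [w, hk, if_true]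
        exact Dvd.dvd.mul_left (dvd_mul_right _ _) _
      · have : C (a h' k) + c k * C (a h' i) = 0 := by
          simp only [c, hk, if_false, neg_mul, ← map_mul, div_mul_cancel₀ _ hi, add_neg_cancel]
        simp [this]
    · refine Dvd.dvd.mul_right ?_ _
      exact Finset.dvd_prod_of_mem (fun h => linPoly (a h) ^ m h)
        (Finset.mem_erase.2 ⟨hh, Finset.mem_univ _⟩)

/-- A free logarithmic derivation module contains independent homogeneous elements whose degrees
add up to at most the sum of the multiplicities. -/
theorem exists_homogeneous_of_basis (ha : ∀ h, a h ≠ 0)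
    (hne : ∀ h h', linPoly (a h) ∣ linPoly (a h') → h = h')
    (b : Module.Basis ι (MvPolynomial ι K) (polyLogDer a m)) :
    ∃ (d : ι → ℕ) (f : ι → ι → MvPolynomial ι K), (∀ i, f i ∈ polyLogDer a m) ∧
      (∀ i j, (f i j).IsHomogeneous (d i)) ∧ (Matrix.of f).det ≠ 0 ∧ ∑ i, d i ≤ ∑ h, m h := by
  let δ := (Matrix.of fun i j => (b i : ι → MvPolynomial ι K) j).det
  have hδ : δ ∣ ∏ h, linPoly (a h) ^ m h := basis_det_dvd_prod ha hne b
  have hP : ∏ h, linPoly (a h) ^ m h ≠ 0 :=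
    Finset.prod_ne_zero_iff.2 fun h _ => pow_ne_zero _ (linPoly_ne_zero (ha h))
  let M : ι → ℕ := fun i => Finset.univ.sup fun j => ((b i : ι → MvPolynomial ι K) j).totalDegree
  let g : ι → ℕ → polyLogDer a m := fun i d =>
    ⟨_, homogeneousComponent_mem_polyLogDer (b i).2 d⟩
  have hg : ∀ i, ∑ d ∈ Finset.range (M i + 1), g i d = b i := fun i => by
    ext j : 2
    rw [Submodule.coe_sum, Finset.sum_apply]
    exact sum_homogeneousComponent_of_le (Finset.le_sup
      (f := fun j => ((b i : ι → MvPolynomial ι K) j).totalDegree) (Finset.mem_univ j))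
  -- The basis itself need not be homogeneous: its determinant, which is 1, is expanded
  -- multilinearly into homogeneous components, and some summand must have nonzero constant term.
  have h1 : ∑ r ∈ Fintype.piFinset fun i => Finset.range (M i + 1),
      b.det (fun i => g i (r i)) = 1 := by
    rw [← b.det_self]
    have := b.det.toMultilinearMap.map_sum_finset g fun i => Finset.range (M i + 1)
    simp only [hg] at this
    exact this.symm
  obtain ⟨r, -, hr⟩ : ∃ r ∈ Fintype.piFinset fun i => Finset.range (M i + 1),
      constantCoeff (b.det fun i => g i (r i)) ≠ 0 := by
    by_contra! hcon
    have := congrArg constantCoeff h1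
    rw [map_sum, Finset.sum_eq_zero hcon, map_one] at this
    exact zero_ne_one this
  have hhom : ∀ i j, ((g i (r i) : ι → MvPolynomial ι K) j).IsHomogeneous (r i) := fun i j =>
    homogeneousComponent_isHomogeneous _ _
  have hδ0 : δ ≠ 0 := ne_zero_of_dvd_ne_zero hP hδ
  have hdet := det_eq_basis_det_mul b fun i => g i (r i)
  refine ⟨r, fun i => g i (r i), fun i => (g i (r i)).2, hhom, ?_, ?_⟩
  · intro h0
    refine mul_ne_zero (fun hu => hr ?_) hδ0 (hdet.symm.trans h0)
    rw [hu, map_zero]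
  · refine (le_totalDegree_of_isHomogeneous_mul hr hδ0 ?_).trans
      ((totalDegree_le_of_dvd_of_isDomain hδ hP).trans totalDegree_prod_linPoly_le)
    rw [← hdet, Matrix.det_apply]
    refine IsHomogeneous.sum _ _ _ fun σ _ => ?_
    have hprod : (∏ i, (Matrix.of fun i j => (g i (r i) : ι → MvPolynomial ι K) j)
        (σ i) i).IsHomogeneous (∑ i, r i) := by
      rw [← Equiv.sum_comp σ r]
      exact IsHomogeneous.prod _ _ _ fun i _ => hhom _ _
    rcases Int.units_eq_one_or (Equiv.Perm.sign σ) with hs | hs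
    · simpa [hs] using hprod
    · simpa [hs] using hprod.neg

end Saito

/-- The rows in `Z` are independent and are supported on the columns outside `C`. -/
theorem card_add_card_le_of_det_ne_zero {R ι : Type*} [CommRing R] [IsDomain R] [Fintype ι]
    [DecidableEq ι] {f : Matrix ι ι R} (hf : f.det ≠ 0) (Z C : Finset ι)
    (h : ∀ i ∈ Z, ∀ j ∈ C, f i j = 0) : Z.card + C.card ≤ Fintype.card ι := by
  have hli : LinearIndependent R fun i : Z => fun j : {j // j ∉ C} => f i j := by
    have hrows := (Matrix.linearIndependent_rows_of_det_ne_zero hf).comp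
      (Subtype.val : Z → ι) Subtype.val_injective
    rw [Fintype.linearIndependent_iff] at hrows ⊢
    refine fun g hg => hrows g ?_
    ext j
    by_cases hj : j ∈ C
    · rw [Finset.sum_apply]
      refine Finset.sum_eq_zero fun i _ => ?_
      change g i * f i j = 0
      rw [h i i.2 j hj, mul_zero]
    · have := congrFun hg ⟨j, hj⟩
      simpa using this
  have := hli.fintype_card_le_finrank
  rw [Module.finrank_fintype_fun_eq_card, Fintype.card_coe, Fintype.card_subtype_compl,
    Fintype.card_coe] at this
  have := C.card_le_univ
  omega

/-! ### A circuit of at least four forms yields a non-free multiplicity. -/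

section Circuit

variable {ι K η : Type*} [Fintype ι] [Field K]

theorem le_of_X_pow_dvd_of_coeff_ne_zero {σ R : Type*} [CommRing R] {i : σ} {n : ℕ} {p : MvPolynomial σ R}
    (h : X i ^ n ∣ p) {s : σ →₀ ℕ} (hs : p.coeff s ≠ 0) : n ≤ s i := by
  classical
  obtain ⟨q, rfl⟩ := h
  rw [X_pow_eq_monomial, coeff_monomial_mul'] at hs
  have : Finsupp.single i n ≤ s := by
    by_contra hle
    simp [hle] at hs
  simpa using this i

/-- A homogeneous relation `∑ cⱼ gⱼ = 0` with `Xⱼ ^ N ∣ gⱼ` and nonzero `gⱼ` lives in degree at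
least `2N`. -/
theorem two_mul_le_of_relation {N d : ℕ} (C' : Finset ι) (c : ι → K) (g : ι → MvPolynomial ι K)
    (hc : ∀ j ∈ C', c j ≠ 0) (hg : ∀ j ∈ C', X j ^ N ∣ g j) (hd : ∀ j, (g j).IsHomogeneous d)
    (hrel : ∑ j ∈ C', C (c j) * g j = 0) {j : ι} (hj : j ∈ C') (hne : g j ≠ 0) : 2 * N ≤ d := by
  classical
  obtain ⟨s, hs⟩ := MvPolynomial.exists_coeff_ne_zero hne
  -- The monomial `s` of `g j` must be cancelled by the same monomial in another `g l`; it is then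
  -- divisible by both X_j^N and X_l^N.
  obtain ⟨l, hl, hlj, hls⟩ : ∃ l ∈ C', l ≠ j ∧ (g l).coeff s ≠ 0 := by
    by_contra! hcon
    have h1 := congrArg (coeff s) hrel
    rw [coeff_sum, Finset.sum_eq_single_of_mem j hj, coeff_C_mul, coeff_zero] at h1
    · exact mul_ne_zero (hc j hj) hs h1
    · intro l hl hlj
      rw [coeff_C_mul, hcon l hl hlj, mul_zero]
  have hdeg : s.degree = d := by
    by_contra hcon
    exact hs ((hd j).coeff_eq_zero hcon)
  have h1 := le_of_X_pow_dvd_of_coeff_ne_zero (hg j hj) hs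
  have h2 := le_of_X_pow_dvd_of_coeff_ne_zero (hg l hl) hls
  have h3 : s l + s j ≤ s.degree := by
    rw [Finsupp.degree_eq_sum, ← Finset.sum_pair hlj]
    exact Finset.sum_le_sum_of_subset (Finset.subset_univ _)
  omega

/-- An arrangement containing a circuit of at least four forms has a non-free multiplicity. -/
theorem not_free_of_circuit [Fintype η] {a : η → ι → K} {m : η → ℕ} (ha : ∀ h, a h ≠ 0)
    (hne : ∀ h h', linPoly (a h) ∣ linPoly (a h') → h = h') [DecidableEq ι]
    (C' : Finset ι) (hC : 3 ≤ C'.card) (H : ι → η) (hH : ∀ j ∈ C', a (H j) = Pi.single j 1)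
    (h₀ : η) (h₀C : ∀ j, a h₀ j ≠ 0 ↔ j ∈ C') {N k r : ℕ} (hmH : ∀ j ∈ C', m (H j) = N)
    (hm₀ : m h₀ = k) (hsum : ∑ h, m h ≤ k + C'.card * N + r) (hN : r < N)
    (hk : C'.card * N + r < k) :
    ¬ Module.Free (MvPolynomial ι K) (polyLogDer a m) := by
  classical
  intro hfree
  obtain ⟨b⟩ := nonempty_basis_polyLogDer ha hfree
  obtain ⟨d, f, hf, hhom, hdet, hd⟩ := exists_homogeneous_of_basis ha hne b
  have hval : ∀ i, d i < k → ∑ j, C (a h₀ j) * f i j = 0 := by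
    intro i hi
    by_contra hcon
    have h1 := totalDegree_le_of_dvd_of_isDomain (hf i h₀) hcon
    have h2 : (∑ j, C (a h₀ j) * f i j).totalDegree ≤ d i :=
      (IsHomogeneous.sum _ _ _ fun j _ => (hhom i j).C_mul _).totalDegree_le
    rw [((linPoly_isHomogeneous (a h₀)).pow (m h₀)).totalDegree
      (pow_ne_zero _ (linPoly_ne_zero (ha h₀))), hm₀] at h1
    omega
  -- Otherwise every row is orthogonal to the nonzero coefficient vector of `a h₀`, and the
  -- determinant vanishes.
  obtain ⟨i₀, hi₀⟩ : ∃ i, k ≤ d i := by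
    by_contra! hcon
    refine hdet (Matrix.exists_mulVec_eq_zero_iff.1 ⟨fun j => C (a h₀ j), ?_, ?_⟩)
    · intro h0
      refine ha h₀ (funext fun j => ?_)
      simpa using congrFun h0 j
    · ext i : 1
      rw [Pi.zero_apply, ← hval i (hcon i)]
      simp [Matrix.mulVec, dotProduct, mul_comm]
  have hsum' := Finset.add_sum_erase Finset.univ d (Finset.mem_univ i₀)
  -- The degrees other than `d i₀` sum to at most |C'| N + r, which is less than k.
  have hlt : ∀ i ≠ i₀, d i < k := by
    intro i hi
    have := Finset.single_le_sum (f := d) (fun _ _ => Nat.zero_le _)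
      (Finset.mem_erase.2 ⟨hi, Finset.mem_univ i⟩)
    omega
  let Z := (Finset.univ.erase i₀).filter fun i => ∀ j ∈ C', f i j = 0
  have hZ := card_add_card_le_of_det_ne_zero hdet Z C' fun i hi j hj =>
    (Finset.mem_filter.1 hi).2 j hj
  let W := (Finset.univ.erase i₀).filter fun i => ¬ ∀ j ∈ C', f i j = 0
  have hZW : Z.card + W.card = Fintype.card ι - 1 := by
    rw [Finset.card_filter_add_card_filter_not, Finset.card_erase_of_mem (Finset.mem_univ _),
      Finset.card_univ]
  have hW : W.card * (2 * N) ≤ ∑ i ∈ Finset.univ.erase i₀, d i := by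
    rw [← smul_eq_mul]
    refine (Finset.card_nsmul_le_sum W d (2 * N) fun i hi => ?_).trans
      (Finset.sum_le_sum_of_subset (Finset.filter_subset _ _))
    obtain ⟨hi, hi'⟩ := Finset.mem_filter.1 hi
    push Not at hi'
    obtain ⟨j, hj, hfj⟩ := hi'
    refine two_mul_le_of_relation C' (a h₀) (f i) (fun j hj => (h₀C j).2 hj) (fun j hj => ?_)
      (hhom i) ?_ hj hfj
    · have := hf i (H j)
      rw [hmH j hj, hH j hj, linPoly_single, Finset.sum_eq_single j] at this
      · simpa using this
      · intro l _ hl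
        simp [hl]
      · simp
    · rw [← hval i (hlt i (Finset.ne_of_mem_erase hi))]
      refine Finset.sum_subset (Finset.subset_univ _) fun j _ hj => ?_
      have : a h₀ j = 0 := by
        by_contra hcon
        exact hj ((h₀C j).1 hcon)
      simp [this]
  -- With n = |C'|, the bounds combine to 2(n - 1)N ≤ nN + r, that is (n - 2)N ≤ r < N,
  -- contradicting n ≥ 3.
  have hWc : C'.card - 1 ≤ W.card := by omega
  have h4 : (C'.card - 1) * (2 * N) ≤ W.card * (2 * N) := Nat.mul_le_mul_right _ hWc
  obtain ⟨c, hc⟩ : ∃ c, C'.card = c + 3 := ⟨C'.card - 3, by omega⟩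
  rw [hc] at h4 hsum
  have h5 : (c + 3 - 1) * (2 * N) = 2 * (c * N) + 4 * N := by
    rw [show c + 3 - 1 = c + 2 by omega]; ring
  have h6 : (c + 3) * N = c * N + 3 * N := by ring
  rw [h5] at h4
  rw [h6] at hsum
  omega

end Circuit

/-! ### Forms in matched pairs of variables: every multiplicity is free. -/

section Matching

variable {ι K : Type*} [DecidableEq ι] [Field K]

/-- The retraction of the polynomial ring killing the variables outside `{Xᵢ, Xⱼ}`. -/
noncomputable def pairRetraction (K : Type*) [Field K] (i j : ι) :
    MvPolynomial ι K →ₐ[K] MvPolynomial ι K :=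
  aeval fun l => if l = i ∨ l = j then X l else 0

theorem pairRetraction_comm (i j : ι) : pairRetraction K i j = pairRetraction K j i := by
  simp only [pairRetraction, or_comm]

/-- The substitution `Xᵢ ↦ -c T`, `Xⱼ ↦ T`, sending all other variables to `0`. -/
noncomputable def pairSubst (i j : ι) (c : K) : MvPolynomial ι K →ₐ[K] Polynomial K :=
  aeval fun l => if l = i then Polynomial.C (-c) * Polynomial.X else
    if l = j then Polynomial.X else 0

/-- A polynomial in `Xᵢ, Xⱼ` is congruent to a polynomial in `Xⱼ` modulo `Xᵢ + c Xⱼ`. -/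
theorem dvd_sub_aeval_pairSubst {i j : ι} {c : K} (hc : i = j → c = 0) {h : MvPolynomial ι K}
    (hh : pairRetraction K i j h = h) :
    X i + C c * X j ∣ h - Polynomial.aeval (X j : MvPolynomial ι K) (pairSubst i j c h) := by
  have key : Polynomial.aeval (X j : MvPolynomial ι K) (pairSubst i j c h) =
      aeval (fun l => if l = i then C (-c) * X j else if l = j then X j else 0) h := by
    have : (Polynomial.aeval (X j : MvPolynomial ι K)).comp (pairSubst i j c) =
        aeval (fun l => if l = i then C (-c) * X j else if l = j then X j else 0) := by
      ext l : 1
      simp only [pairSubst, AlgHom.comp_apply, aeval_X]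
      split_ifs <;> simp [algebraMap_eq]
    exact DFunLike.congr_fun this h
  rw [key]
  nth_rw 1 [← hh]
  refine dvd_aeval_sub_aeval _ _ _ (fun l => ?_) h
  by_cases hi : l = i
  · subst hi; simp
  · by_cases hj : l = j
    · have hji : j ≠ i := hj ▸ hi
      simp [hj, hji]
    · simp [hi, hj]

/-- Bézout data for a pair of univariate polynomials over a field. -/
theorem exists_bezout (p q : Polynomial K) (hpq : ¬ (p = 0 ∧ q = 0)) :
    ∃ d u v r s : Polynomial K, d ≠ 0 ∧ p = d * u ∧ q = d * v ∧ r * u + s * v = 1 := by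
  classical
  have hd : EuclideanDomain.gcd p q ≠ 0 := fun h => hpq (EuclideanDomain.gcd_eq_zero_iff.1 h)
  obtain ⟨u, hu⟩ := EuclideanDomain.gcd_dvd_left p q
  obtain ⟨v, hv⟩ := EuclideanDomain.gcd_dvd_right p q
  refine ⟨_, u, v, EuclideanDomain.gcdA p q, EuclideanDomain.gcdB p q, hd, hu, hv, ?_⟩
  have h := EuclideanDomain.gcd_eq_gcd_ab p q
  refine mul_left_cancel₀ hd ?_
  calc _ = (EuclideanDomain.gcd p q * u) * EuclideanDomain.gcdA p q +
        (EuclideanDomain.gcd p q * v) * EuclideanDomain.gcdB p q := by ring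
    _ = p * EuclideanDomain.gcdA p q + q * EuclideanDomain.gcdB p q := by rw [← hu, ← hv]
    _ = EuclideanDomain.gcd p q * 1 := by rw [← h, mul_one]

/-- The solutions of a linear congruence in two unknowns whose coefficients reduce to multiples
of a nonzerodivisor `d` are parametrized by the invertible substitution below. -/
theorem exists_parametrization {R : Type*} [CommRing R] [IsDomain R] {α d u v r s h₁ h₂ : R}
    (hα : Prime α) (hd : ¬ α ∣ d) (hrs : r * u + s * v = 1) (h₁u : α ∣ h₁ - d * u)
    (h₂v : α ∣ h₂ - d * v) (x y : R) : α ∣ h₁ * x + h₂ * y ↔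
      ∃ f g, r * α * f - v * g = x ∧ s * α * f + u * g = y := by
  have hred : α ∣ h₁ * x + h₂ * y ↔ α ∣ u * x + v * y := by
    have h1 : α ∣ (h₁ * x + h₂ * y) - d * (u * x + v * y) := by
      have := dvd_add (h₁u.mul_right x) (h₂v.mul_right y)
      convert this using 1; ring
    rw [(dvd_iff_dvd_of_dvd_sub h1), hα.dvd_mul, or_iff_right hd]
  rw [hred]
  constructor
  · rintro ⟨f, hf⟩
    -- The matrix with rows (r, -v) and (s, u) has determinant 1; its inverse sends (x, y) to (ux +
    -- vy, ry - sx), and the first entry is αf.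
    refine ⟨f, r * y - s * x, ?_, ?_⟩
    · linear_combination -r * hf + x * hrs
    · linear_combination -s * hf + y * hrs
  · rintro ⟨f, g, rfl, rfl⟩
    refine ⟨f, ?_⟩
    linear_combination α * f * hrs

/-- The linear endomorphism `Φ` of `ι → K[X]` respects the matching given by the involution `σ`: its
columns with indices `k, σ k` have entries in `K[X_k, X_{σ k}]`, in the rows `k, σ k` only. -/
structure RespectsMatching (σ : ι → ι)
    (Φ : (ι → MvPolynomial ι K) →ₗ[MvPolynomial ι K] (ι → MvPolynomial ι K)) : Prop where
  support : ∀ k l, l ≠ k → l ≠ σ k → Φ (Pi.single k 1) l = 0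
  fixed : ∀ k l, pairRetraction K k (σ k) (Φ (Pi.single k 1) l) = Φ (Pi.single k 1) l

theorem RespectsMatching.id (σ : ι → ι) :
    RespectsMatching σ (LinearMap.id : (ι → MvPolynomial ι K) →ₗ[MvPolynomial ι K] _) where
  support k l hk _ := by simp [hk]
  fixed k l := by
    rw [LinearMap.id_apply, Pi.single_apply]
    split_ifs <;> simp

variable [Fintype ι]

theorem linearMap_apply_eq_sum {R : Type*} [CommRing R] (Φ : (ι → R) →ₗ[R] (ι → R)) (f : ι → R)
    (l : ι) : Φ f l = ∑ k, f k * Φ (Pi.single k 1) l := by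
  rw [Φ.pi_apply_eq_sum_univ, Finset.sum_apply]
  refine Finset.sum_congr rfl fun k _ => ?_
  simp only [Pi.smul_apply, smul_eq_mul]
  have : (fun j => if k = j then (1 : R) else 0) = Pi.single k 1 := by
    ext j
    simp [Pi.single_apply, eq_comm]
  rw [this]

/-- These maps are block diagonal along the orbits of σ. As σ is an involution, columns `k` and `σ
k` belong to the same block and use the same two variables. -/
theorem RespectsMatching.comp {σ : ι → ι} (hσ : ∀ i, σ (σ i) = i)
    {Φ Ψ : (ι → MvPolynomial ι K) →ₗ[MvPolynomial ι K] (ι → MvPolynomial ι K)}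
    (hΦ : RespectsMatching σ Φ) (hΨ : RespectsMatching σ Ψ) : RespectsMatching σ (Φ ∘ₗ Ψ) where
  support k l h₁ h₂ := by
    rw [LinearMap.comp_apply, linearMap_apply_eq_sum]
    refine Finset.sum_eq_zero fun j _ => ?_
    by_cases hk : j = k
    · rw [hk, hΦ.support k l h₁ h₂, mul_zero]
    · by_cases hk' : j = σ k
      · rw [hk', hΦ.support (σ k) l h₂ (by rwa [hσ]), mul_zero]
      · rw [hΨ.support k j hk hk', zero_mul]
  fixed k l := by
    rw [LinearMap.comp_apply, linearMap_apply_eq_sum, map_sum]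
    refine Finset.sum_congr rfl fun j _ => ?_
    rw [map_mul, hΨ.fixed]
    by_cases hk : j = k
    · rw [hk, hΦ.fixed]
    · by_cases hk' : j = σ k
      · have := hΦ.fixed (σ k) l
        rw [hσ, pairRetraction_comm] at this
        rw [hk', this]
      · rw [hΨ.support k j hk hk', zero_mul, zero_mul]

theorem sum_C_single_add_single_mul (i j : ι) (c : K) (f : ι → MvPolynomial ι K) :
    ∑ l, C ((Pi.single i 1 + Pi.single j c : ι → K) l) * f l = f i + C c * f j := by
  simp only [Pi.add_apply, map_add, add_mul, Finset.sum_add_distrib, Pi.single_apply, apply_ite C,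
    ite_mul]
  simp

/-- Raising by one the multiplicity of the form `Xᵢ + c X_{σ i}` preserves the existence of a
parametrization that respects the matching. -/
theorem RespectsMatching.exists_step {σ : ι → ι} (hσ : ∀ i, σ (σ i) = i)
    {D D' : Submodule (MvPolynomial ι K) (ι → MvPolynomial ι K)} {i : ι} {c : K} {n : ℕ}
    (hc : σ i = i → c = 0)
    (hD : ∀ f ∈ D, (X i + C c * X (σ i)) ^ n ∣ f i + C c * f (σ i))
    (hD' : ∀ f, f ∈ D' ↔ f ∈ D ∧ (X i + C c * X (σ i)) ^ (n + 1) ∣ f i + C c * f (σ i))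
    {Φ : (ι → MvPolynomial ι K) →ₗ[MvPolynomial ι K] (ι → MvPolynomial ι K)}
    (hΦ : RespectsMatching σ Φ) (hinj : Function.Injective Φ) (hr : LinearMap.range Φ = D) :
    ∃ Φ' : (ι → MvPolynomial ι K) →ₗ[MvPolynomial ι K] (ι → MvPolynomial ι K),
      RespectsMatching σ Φ' ∧ Function.Injective Φ' ∧ LinearMap.range Φ' = D' := by
  set α : MvPolynomial ι K := X i + C c * X (σ i) with hα_def
  have hαlin : α = linPoly (Pi.single i 1 + Pi.single (σ i) c) :=
    (sum_C_single_add_single_mul i (σ i) c X).symm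
  have hαne : (Pi.single i 1 + Pi.single (σ i) c : ι → K) ≠ 0 := by
    intro h
    have := congrFun h i
    by_cases hi : σ i = i
    · simp [hi, hc hi] at this
    · simp [Ne.symm hi] at this
  have hα : Prime α := hαlin ▸ linPoly_prime hαne
  have hαfix : pairRetraction K i (σ i) α = α := by simp [hα_def, pairRetraction]
  -- After pulling back along Φ, the additional condition is a single congruence modulo α on the
  -- parameters, and it suffices to parametrize its solutions.
  suffices hΨ : ∃ Ψ : (ι → MvPolynomial ι K) →ₗ[MvPolynomial ι K] (ι → MvPolynomial ι K),
      RespectsMatching σ Ψ ∧ Function.Injective Ψ ∧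
        ∀ f, f ∈ LinearMap.range Ψ ↔ α ^ (n + 1) ∣ Φ f i + C c * Φ f (σ i) by
    obtain ⟨Ψ, h₁, h₂, h₃⟩ := hΨ
    refine ⟨Φ ∘ₗ Ψ, hΦ.comp hσ h₁, hinj.comp h₂, ?_⟩
    ext g
    rw [hD', ← hr]
    constructor
    · rintro ⟨f, rfl⟩
      exact ⟨⟨Ψ f, rfl⟩, (h₃ (Ψ f)).1 ⟨f, rfl⟩⟩
    · rintro ⟨⟨f, rfl⟩, hf⟩
      obtain ⟨f', rfl⟩ := (h₃ f).2 hf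
      exact ⟨f', rfl⟩
  have hh : ∀ k, ∃ h, Φ (Pi.single k 1) i + C c * Φ (Pi.single k 1) (σ i) = α ^ n * h :=
    fun k => hD _ (hr ▸ ⟨_, rfl⟩)
  choose h hh using hh
  have hαn : α ^ n ≠ 0 := pow_ne_zero _ hα.ne_zero
  have hzero : ∀ k, k ≠ i → k ≠ σ i → h k = 0 := by
    intro k h₁ h₂
    have := hh k
    rw [hΦ.support k i (Ne.symm h₁) fun h => h₂ (by rw [h, hσ]),
      hΦ.support k (σ i) (Ne.symm h₂) fun h => h₁ (by rw [← hσ k, ← h, hσ])] at this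
    simpa [hαn] using this.symm
  have hsum : ∀ f, Φ f i + C c * Φ f (σ i) = α ^ n * ∑ k, h k * f k := by
    intro f
    rw [linearMap_apply_eq_sum, linearMap_apply_eq_sum, Finset.mul_sum, Finset.mul_sum,
      ← Finset.sum_add_distrib]
    refine Finset.sum_congr rfl fun k _ => ?_
    linear_combination f k * hh k
  simp only [hsum, pow_succ, mul_dvd_mul_iff_left hαn]
  -- If α divides all coefficients, the congruence is void and the module does not change.
  by_cases hall : ∀ k, α ∣ h k
  · exact ⟨LinearMap.id, .id σ, Function.injective_id, fun f =>
      ⟨fun _ => Finset.dvd_sum fun k _ => (hall k).mul_right _, fun _ => ⟨f, rfl⟩⟩⟩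
  -- For an unmatched variable only coordinate `i` enters, and the congruence says that α divides
  -- it.
  by_cases hi : σ i = i
  · have hz : ∀ k ≠ i, h k = 0 := fun k hk => hzero k hk (by rwa [hi])
    have hi' : ¬ α ∣ h i := fun hd => hall fun k => by
      by_cases hk : k = i
      · rwa [hk]
      · simp [hz k hk]
    let w : ι → MvPolynomial ι K := fun l => if l = i then α else 1
    have hw : ∀ l, w l ≠ 0 := fun l => by
      simp only [w]; split_ifs
      exacts [hα.ne_zero, one_ne_zero]
    refine ⟨LinearMap.pi fun l => w l • LinearMap.proj l, ⟨?_, ?_⟩, ?_, ?_⟩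
    · intro k l hk _
      simp [hk]
    · intro k l
      by_cases hk : l = k
      · subst hk
        by_cases hl : l = i
        · subst hl
          simpa [w] using hαfix
        · simp [w, hl]
      · simp [hk]
    · intro f g hfg
      ext l : 1
      exact mul_left_cancel₀ (hw l) (congrFun hfg l)
    · intro f
      rw [Finset.sum_eq_single_of_mem i (Finset.mem_univ _) fun k _ hk => by simp [hz k hk],
        hα.dvd_mul, or_iff_right hi']
      constructor
      · rintro ⟨g, rfl⟩
        simp [w]
      · rintro ⟨g, hg⟩
        refine ⟨Function.update f i g, funext fun l => ?_⟩
        by_cases hl : l = i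
        · subst hl; simp [w, hg]
        · simp [w, hl]
  · have hij : i ≠ σ i := Ne.symm hi
    set j := σ i with hj
    have hfix : ∀ k, (k = i ∨ k = j) → pairRetraction K i j (h k) = h k := by
      intro k hk
      have hΦk : ∀ l, pairRetraction K i j (Φ (Pi.single k 1) l) = Φ (Pi.single k 1) l := by
        rcases hk with rfl | rfl
        · exact hΦ.fixed k
        · intro l
          have := hΦ.fixed j l
          rwa [hj, hσ, pairRetraction_comm] at this
      have := congrArg (pairRetraction K i j) (hh k)
      rw [map_add, map_mul, map_mul, map_pow, hαfix, hΦk, hΦk, ← algebraMap_eq, AlgHom.commutes,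
        algebraMap_eq, hh k] at this
      exact (mul_left_cancel₀ hαn this).symm
    let T : Polynomial K →ₐ[K] MvPolynomial ι K := Polynomial.aeval (X j)
    have hcong : ∀ k, (k = i ∨ k = j) → α ∣ h k - T (pairSubst i j c (h k)) := fun k hk =>
      dvd_sub_aeval_pairSubst (fun h => absurd h hij) (hfix k hk)
    have hTfix : ∀ p, pairRetraction K i j (T p) = T p := by
      intro p
      have : (pairRetraction K i j).comp T = T := by
        ext; simp [T, pairRetraction]
      exact DFunLike.congr_fun this p
    -- Restriction to the line α = 0 kills α but recovers `p` from `T p`, so α divides no nonzero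
    -- polynomial in X_j alone.
    have hTdvd : ∀ p, α ∣ T p → p = 0 := by
      rintro p ⟨q, hq⟩
      have h1 : pairSubst i j c (T p) = p := by
        have : (pairSubst i j c).comp T = AlgHom.id K _ := by
          ext; simp [T, pairSubst, hi]
        exact DFunLike.congr_fun this p
      have h2 : pairSubst i j c α = 0 := by
        have hCc : pairSubst i j c (C c) = Polynomial.C c := AlgHom.commutes _ c
        rw [hα_def, map_add, map_mul, hCc]
        simp [pairSubst, hi]
      rw [← h1, hq, map_mul, h2, zero_mul]
    -- Modulo α both coefficients become univariate, where Bézout applies. They do not both reduce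
    -- to zero, since α would then divide every `h k`.
    obtain ⟨d, u, v, r, s, hd, hu, hv, hrs⟩ :=
      exists_bezout (pairSubst i j c (h i)) (pairSubst i j c (h j)) (by
        rintro ⟨h₁, h₂⟩
        refine hall fun k => ?_
        by_cases hk : k = i
        · simpa [hk, h₁] using hcong i (.inl rfl)
        · by_cases hk' : k = j
          · simpa [hk', h₂] using hcong j (.inr rfl)
          · simp [hzero k hk hk'])
    have hrs' : T r * T u + T s * T v = 1 := by rw [← map_mul, ← map_mul, ← map_add, hrs, map_one]
    have hparam := exists_parametrization hα (fun h => hd (hTdvd d h)) hrs'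
      (by simpa [hu] using hcong i (.inl rfl)) (by simpa [hv] using hcong j (.inr rfl))
    let Ψ : (ι → MvPolynomial ι K) →ₗ[MvPolynomial ι K] (ι → MvPolynomial ι K) :=
      LinearMap.pi fun l =>
        if l = i then (T r * α) • LinearMap.proj i - T v • LinearMap.proj j
        else if l = j then (T s * α) • LinearMap.proj i + T u • LinearMap.proj j
        else LinearMap.proj l
    have hΨi : ∀ f, Ψ f i = T r * α * f i - T v * f j := fun f => by simp [Ψ]
    have hΨj : ∀ f, Ψ f j = T s * α * f i + T u * f j := fun f => by simp [Ψ, hi]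
    have hΨl : ∀ f l, l ≠ i → l ≠ j → Ψ f l = f l := fun f l h₁ h₂ => by simp [Ψ, h₁, h₂]
    have hσj : σ j = i := by rw [hj, hσ]
    refine ⟨Ψ, ⟨?_, ?_⟩, ?_, ?_⟩
    · intro k l h₁ h₂
      by_cases hli : l = i
      · have hkj : k ≠ j := fun h => h₂ (by rw [h, hσj, hli])
        rw [hli, hΨi]
        simp [Ne.symm hkj, hli ▸ h₁]
      · by_cases hlj : l = j
        · have hki : k ≠ i := fun h => h₂ (by rw [h, hlj])
          rw [hlj, hΨj]
          simp [Ne.symm hki, hlj ▸ h₁]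
        · rw [hΨl _ _ hli hlj]
          simp [h₁]
    · intro k l
      by_cases hk : k = i ∨ k = j
      · have hret : pairRetraction K k (σ k) = pairRetraction K i j := by
          rcases hk with rfl | rfl
          · rfl
          · rw [hσj, pairRetraction_comm]
        have hs : ∀ l, pairRetraction K i j ((Pi.single k 1 : ι → MvPolynomial ι K) l) =
            (Pi.single k 1 : ι → MvPolynomial ι K) l := fun l => by
          rw [Pi.single_apply]; split_ifs <;> simp
        rw [hret]
        by_cases hli : l = i
        · rw [hli, hΨi]
          simp only [map_sub, map_mul, hTfix, hαfix, hs]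
        · by_cases hlj : l = j
          · rw [hlj, hΨj]
            simp only [map_add, map_mul, hTfix, hαfix, hs]
          · rw [hΨl _ _ hli hlj, hs]
      · push Not at hk
        have : Ψ (Pi.single k 1) = Pi.single k 1 := by
          ext l : 1
          by_cases hli : l = i
          · rw [hli, hΨi]; simp [Ne.symm hk.1, Ne.symm hk.2]
          · by_cases hlj : l = j
            · rw [hlj, hΨj]; simp [Ne.symm hk.1, Ne.symm hk.2]
            · exact hΨl _ _ hli hlj
        rw [this, Pi.single_apply]
        split_ifs <;> simp
    · refine (injective_iff_map_eq_zero Ψ).2 fun f hf => ?_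
      have h₁ := (hΨi f).symm.trans (congrFun hf i)
      have h₂ := (hΨj f).symm.trans (congrFun hf j)
      simp only [Pi.zero_apply] at h₁ h₂
      have hfi : f i = 0 := by
        refine (mul_eq_zero.1 (?_ : α * f i = 0)).resolve_left hα.ne_zero
        linear_combination T u * h₁ + T v * h₂ - α * f i * hrs'
      have hfj : f j = 0 := by
        linear_combination T r * h₂ - T s * h₁ - f j * hrs'
      ext l : 1
      by_cases hli : l = i
      · rw [hli, hfi, Pi.zero_apply]
      · by_cases hlj : l = j
        · rw [hlj, hfj, Pi.zero_apply]
        · rw [← hΨl f l hli hlj, hf]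
    · intro f
      have : ∑ k, h k * f k = h i * f i + h j * f j := by
        rw [← Finset.sum_pair (f := fun k => h k * f k) hij]
        refine (Finset.sum_subset (Finset.subset_univ _) fun k _ hk => ?_).symm
        simp only [Finset.mem_insert, Finset.mem_singleton, not_or] at hk
        rw [hzero k hk.1 hk.2, zero_mul]
      rw [this, hparam]
      constructor
      · rintro ⟨g, rfl⟩
        exact ⟨g i, g j, (hΨi g).symm, (hΨj g).symm⟩
      · rintro ⟨x, y, hx, hy⟩
        refine ⟨Function.update (Function.update f i x) j y, funext fun l => ?_⟩
        by_cases hli : l = i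
        · rw [hli, hΨi]; simp [hij, hx]
        · by_cases hlj : l = j
          · rw [hlj, hΨj]; simp [hij, hy]
          · rw [hΨl _ _ hli hlj]; simp [hli, hlj]

/-- If all forms are of the shape `Xᵢ + c X_{σ i}` for an involution `σ` of the variables, then
every multiplicity is free. -/
theorem free_polyLogDer_of_matching {η : Type*} [Fintype η] {σ : ι → ι} (hσ : ∀ i, σ (σ i) = i)
    (i : η → ι) (c : η → K) (hc : ∀ h, σ (i h) = i h → c h = 0) (m : η → ℕ) :
    Module.Free (MvPolynomial ι K)
      (polyLogDer (fun h => (Pi.single (i h) 1 + Pi.single (σ (i h)) (c h) : ι → K)) m) := by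
  classical
  set a : η → ι → K := fun h => Pi.single (i h) 1 + Pi.single (σ (i h)) (c h)
  have hlin : ∀ h, linPoly (a h) = X (i h) + C (c h) * X (σ (i h)) := fun h =>
    sum_C_single_add_single_mul (i h) (σ (i h)) (c h) X
  have hval : ∀ h (f : ι → MvPolynomial ι K),
      ∑ l, C (a h l) * f l = f (i h) + C (c h) * f (σ (i h)) := fun h f =>
    sum_C_single_add_single_mul (i h) (σ (i h)) (c h) f
  suffices ∀ (n : ℕ) (m : η → ℕ), ∑ h, m h = n →
      ∃ Φ : (ι → MvPolynomial ι K) →ₗ[MvPolynomial ι K] (ι → MvPolynomial ι K),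
        RespectsMatching σ Φ ∧ Function.Injective Φ ∧ LinearMap.range Φ = polyLogDer a m by
    obtain ⟨Φ, -, h₁, h₂⟩ := this _ m rfl
    rw [← h₂]
    exact Module.Free.of_equiv (LinearEquiv.ofInjective Φ h₁)
  intro n
  induction n with
  | zero =>
    -- Multiplicity zero imposes no condition; the induction starts here, which is why `polyLogDer`
    -- admits multiplicities in ℕ.
    intro m hm
    refine ⟨LinearMap.id, .id σ, Function.injective_id, ?_⟩
    rw [LinearMap.range_id, eq_comm, eq_top_iff]
    intro f _ h
    rw [Finset.sum_eq_zero_iff.1 hm h (Finset.mem_univ h), pow_zero]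
    exact one_dvd _
  | succ n ih =>
    intro m hm
    obtain ⟨h₀, -, hh₀⟩ : ∃ h ∈ Finset.univ, m h ≠ 0 := by
      by_contra! hcon
      rw [Finset.sum_eq_zero hcon] at hm
      omega
    obtain ⟨q, hq⟩ := Nat.exists_eq_succ_of_ne_zero hh₀
    obtain ⟨Φ, h₁, h₂, h₃⟩ := ih (Function.update m h₀ q) (by
      rw [Finset.sum_update_of_mem (Finset.mem_univ _)]
      rw [← Finset.add_sum_erase _ _ (Finset.mem_univ h₀), hq, ← Finset.sdiff_singleton_eq_erase]
        at hm
      omega)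
    refine h₁.exists_step hσ (hc h₀) (n := q) (fun f hf => ?_) (fun f => ?_) h₂ h₃
    · have := hf h₀
      rwa [hlin, hval, Function.update_self] at this
    · simp only [mem_polyLogDer]
      constructor
      · refine fun hf => ⟨fun h => ?_, ?_⟩
        · by_cases hh : h = h₀
          · subst hh
            refine dvd_trans (pow_dvd_pow _ ?_) (hf h)
            rw [Function.update_self, hq]; omega
          · rw [Function.update_of_ne hh]
            exact hf h
        · have := hf h₀
          rwa [hlin, hval, hq] at this
      · rintro ⟨hf, hf₀⟩ h
        by_cases hh : h = h₀
        · subst hh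
          rwa [hlin, hval, hq]
        · have := hf h
          rwa [Function.update_of_ne hh] at this

end Matching

theorem Module.Basis.sumExtend_inl {K V ι : Type*} [DivisionRing K] [AddCommGroup V] [Module K V]
    {v : ι → V} (hs : LinearIndependent K v) (i : ι) : Module.Basis.sumExtend hs (.inl i) = v i := by
  simp only [Module.Basis.sumExtend, Module.Basis.coe_reindex, Function.comp_apply,
    Module.Basis.extend_apply_self]
  rfl

/-! ### From derivations of Sym(V*) to coefficient vectors. -/

namespace CentralArrangement

section

variable {K V : Type*} [Field K] [AddCommGroup V] [Module K V]

/-- The coordinate isomorphism `Sym(V*) ≃ K[Xᵢ]` sends a linear form to a linear polynomial. -/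
theorem equivMvPolynomial_linForm {ι : Type*} [Fintype ι] (B : Module.Basis ι K (Module.Dual K V))
    (α : Module.Dual K V) :
    SymmetricAlgebra.equivMvPolynomial B (linForm α) = linPoly fun i => B.repr α i := by
  refine (congrArg (fun β => SymmetricAlgebra.equivMvPolynomial B (linForm β))
    (B.sum_repr α)).symm.trans ?_
  simp only [linForm, linPoly, map_sum, map_smul, smul_eq_C_mul,
    SymmetricAlgebra.equivMvPolynomial_ι_apply]

theorem exists_smul_of_ker_le_ker {α β : Module.Dual K V}
    (h : LinearMap.ker α ≤ LinearMap.ker β) : ∃ c : K, β = c • α := by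
  have := mem_span_of_iInf_ker_le_ker (ι := Unit) (L := fun _ => α) (K := β) (by simpa using h)
  rw [Set.range_const, Submodule.mem_span_singleton] at this
  obtain ⟨c, hc⟩ := this
  exact ⟨c, hc.symm⟩

theorem exists_ker_eq_of_isCoatom {H : Submodule K V} (hH : IsCoatom H) :
    ∃ α : Module.Dual K V, LinearMap.ker α = H := by
  obtain ⟨α, hα, hle⟩ := H.exists_le_ker_of_lt_top hH.lt_top
  exact ⟨α, (hH.le_iff_eq fun h => hα (LinearMap.ker_eq_top.1 h)).1 hle⟩

theorem ne_zero_of_isCoatom_ker {α : Module.Dual K V} (h : IsCoatom (LinearMap.ker α)) : α ≠ 0 :=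
  fun h0 => h.1 (by rw [h0, LinearMap.ker_zero])

/-- Proportional forms differ by a unit, so one chosen form per hyperplane suffices. -/
theorem mem_logDer_iff {A : CentralArrangement K V} {m : A.hyperplanes → ℕ+}
    {α : A.hyperplanes → Module.Dual K V} (hα : ∀ H, LinearMap.ker (α H) = H.1)
    {θ : Derivation K (CoordRing K V) (CoordRing K V)} :
    θ ∈ A.logDer m ↔ ∀ H, linForm (α H) ^ (m H : ℕ) ∣ θ (linForm (α H)) := by
  constructor
  · exact fun h H => Ideal.mem_span_singleton.1 (h H (α H) (hα H))
  · intro h H β hβ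
    obtain ⟨c, rfl⟩ := exists_smul_of_ker_le_ker (hβ.trans (hα H).symm).ge
    have hc : c ≠ 0 := by
      rintro rfl
      rw [zero_smul, LinearMap.ker_zero] at hβ
      exact (A.isCoatom H.1 H.2).1 hβ.symm
    have hu : IsUnit (algebraMap K (CoordRing K V) c) := (IsUnit.mk0 c hc).map _
    rw [Ideal.mem_span_singleton, linForm, map_smul, Derivation.map_smul, Algebra.smul_def,
      Algebra.smul_def, mul_pow, (hu.pow _).mul_left_dvd, hu.dvd_mul_left]
    exact h H

/-- The derivation of `Sym(V*)` with prescribed values on a basis of `V*`. -/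
noncomputable def derivationOfBasis {ι : Type*} (B : Module.Basis ι K (Module.Dual K V))
    (f : ι → MvPolynomial ι K) : Derivation K (CoordRing K V) (CoordRing K V) :=
  Derivation.mk' ((SymmetricAlgebra.equivMvPolynomial B).symm.toLinearMap ∘ₗ
      (mkDerivation K f).toLinearMap ∘ₗ (SymmetricAlgebra.equivMvPolynomial B).toLinearMap)
    fun s t => by simp

theorem derivationOfBasis_linForm {ι : Type*} (B : Module.Basis ι K (Module.Dual K V))
    (f : ι → MvPolynomial ι K) (i : ι) : SymmetricAlgebra.equivMvPolynomial B
      (derivationOfBasis B f (linForm (B i))) = f i := by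
  change SymmetricAlgebra.equivMvPolynomial B ((SymmetricAlgebra.equivMvPolynomial B).symm
    (mkDerivation K f (SymmetricAlgebra.equivMvPolynomial B (linForm (B i))))) = f i
  rw [AlgEquiv.apply_symm_apply, SymmetricAlgebra.equivMvPolynomial_ι_apply, mkDerivation_X]

theorem equivMvPolynomial_derivation_linForm {ι : Type*} [Fintype ι]
    (B : Module.Basis ι K (Module.Dual K V)) (θ : Derivation K (CoordRing K V) (CoordRing K V))
    (α : Module.Dual K V) : SymmetricAlgebra.equivMvPolynomial B (θ (linForm α)) =
      ∑ i, C (B.repr α i) * SymmetricAlgebra.equivMvPolynomial B (θ (linForm (B i))) := by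
  refine (congrArg (fun β => SymmetricAlgebra.equivMvPolynomial B (θ (linForm β)))
    (B.sum_repr α)).symm.trans ?_
  simp only [linForm, map_sum, map_smul, Derivation.map_smul, smul_eq_C_mul]

theorem derivation_ext_of_basis {ι : Type*} (B : Module.Basis ι K (Module.Dual K V))
    {θ η : Derivation K (CoordRing K V) (CoordRing K V)}
    (h : ∀ i, θ (linForm (B i)) = η (linForm (B i))) : θ = η := by
  have hlin : θ.toLinearMap ∘ₗ SymmetricAlgebra.ι K (Module.Dual K V) =
      η.toLinearMap ∘ₗ SymmetricAlgebra.ι K (Module.Dual K V) := B.ext h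
  ext s
  induction s using SymmetricAlgebra.induction with
  | algebraMap r => simp
  | ι x => exact DFunLike.congr_fun hlin x
  | mul a b ha hb => simp [ha, hb]
  | add a b ha hb => simp [ha, hb]

theorem mem_logDer_iff_polyLogDer {ι : Type*} [Fintype ι]
    (B : Module.Basis ι K (Module.Dual K V)) {A : CentralArrangement K V}
    {α : A.hyperplanes → Module.Dual K V} (hα : ∀ H, LinearMap.ker (α H) = H.1)
    {m : A.hyperplanes → ℕ+} {θ : Derivation K (CoordRing K V) (CoordRing K V)} :
    θ ∈ A.logDer m ↔ (fun i => SymmetricAlgebra.equivMvPolynomial B (θ (linForm (B i)))) ∈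
      polyLogDer (fun H i => B.repr (α H) i) fun H => (m H : ℕ) := by
  rw [mem_logDer_iff hα, mem_polyLogDer]
  refine forall_congr' fun H => ?_
  rw [← equivMvPolynomial_derivation_linForm, ← equivMvPolynomial_linForm,
    ← map_pow (SymmetricAlgebra.equivMvPolynomial B)]
  exact (map_dvd_iff (SymmetricAlgebra.equivMvPolynomial B)).symm

/-- In coordinates, the logarithmic derivation module is `polyLogDer`. -/
theorem free_logDer_iff {ι : Type*} [Fintype ι] (B : Module.Basis ι K (Module.Dual K V))
    {A : CentralArrangement K V} {α : A.hyperplanes → Module.Dual K V}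
    (hα : ∀ H, LinearMap.ker (α H) = H.1) (m : A.hyperplanes → ℕ+) :
    Module.Free (CoordRing K V) (A.logDer m) ↔ Module.Free (MvPolynomial ι K)
      (polyLogDer (fun H i => B.repr (α H) i) fun H => (m H : ℕ)) := by
  -- The two modules live over different rings, so they are compared by an equivalence semilinear
  -- along this isomorphism.
  let e : CoordRing K V ≃+* MvPolynomial ι K := (SymmetricAlgebra.equivMvPolynomial B).toRingEquiv
  have := RingHomInvPair.of_ringEquiv e
  have := RingHomInvPair.of_ringEquiv_symm e
  have hmem : ∀ θ : Derivation K (CoordRing K V) (CoordRing K V), θ ∈ A.logDer m ↔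
      (fun i => e (θ (linForm (B i)))) ∈
        polyLogDer (fun H i => B.repr (α H) i) fun H => (m H : ℕ) := fun _ =>
    mem_logDer_iff_polyLogDer B hα
  let F : A.logDer m →ₛₗ[(e : CoordRing K V →+* MvPolynomial ι K)]
      polyLogDer (fun H i => B.repr (α H) i) fun H => (m H : ℕ) :=
    { toFun := fun θ => ⟨fun i => e (θ.1 (linForm (B i))), (hmem θ.1).1 θ.2⟩
      map_add' := fun θ η => Subtype.ext (funext fun i => map_add e _ _)
      map_smul' := fun s θ => Subtype.ext (funext fun i => map_mul e _ _) }
  refine Module.Free.iff_of_equiv (LinearEquiv.ofBijective F ⟨fun θ η h => ?_, fun f => ?_⟩)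
  · refine Subtype.ext (derivation_ext_of_basis B fun i => e.injective ?_)
    exact congrFun (congrArg Subtype.val h) i
  · have hf : (fun i => e (derivationOfBasis B f.1 (linForm (B i)))) = f.1 :=
      funext fun i => derivationOfBasis_linForm B f.1 i
    exact ⟨⟨derivationOfBasis B f.1, (hmem _).2 (by rw [hf]; exact f.2)⟩, Subtype.ext hf⟩

end

end CentralArrangement

/-! ### Small circuits: inheritance, and equivalence with total freeness. -/

namespace CentralArrangement

section

variable {K V : Type*} [Field K] [AddCommGroup V] [Module K V]

/-- All circuits formed by defining forms of the hyperplanes of `A` have at most three elements. -/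
def HasSmallCircuits (A : CentralArrangement K V) : Prop :=
  ∀ (n : ℕ) (x : Fin n → Module.Dual K V) (a : Fin n → K), LinearIndependent K x →
    (∀ i, LinearMap.ker (x i) ∈ A.hyperplanes) →
    LinearMap.ker (∑ i, a i • x i) ∈ A.hyperplanes → (∀ i, a i ≠ 0) → n ≤ 2

theorem HasSmallCircuits.of_isSubarrangement {A B : CentralArrangement K V}
    (hA : A.HasSmallCircuits) (h : B.IsSubarrangement A) : B.HasSmallCircuits :=
  fun n x a hx hxB hB ha => hA n x a hx (fun i => h (hxB i)) (h hB) ha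

theorem HasSmallCircuits.card_le_two {A : CentralArrangement K V} (hA : A.HasSmallCircuits)
    {τ : Type*} [Fintype τ] (x : τ → Module.Dual K V) (a : τ → K) (hx : LinearIndependent K x)
    (hxA : ∀ i, LinearMap.ker (x i) ∈ A.hyperplanes)
    (hA' : LinearMap.ker (∑ i, a i • x i) ∈ A.hyperplanes) (ha : ∀ i, a i ≠ 0) :
    Fintype.card τ ≤ 2 := by
  let e := (Fintype.equivFin τ).symm
  refine hA _ (x ∘ e) (a ∘ e) (hx.comp e e.injective) (fun i => hxA _) ?_ fun i => ha _
  have : ∑ i, (a ∘ e) i • (x ∘ e) i = ∑ i, a i • x i := e.sum_comp fun i => a i • x i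
  rwa [this]

/-- A defining form of a hyperplane of the restriction lifts to one of a hyperplane of `A`. -/
theorem exists_lift_of_ker_mem_restriction {A : CentralArrangement K V} {H₀ : Submodule K V}
    {h₀ : H₀ ∈ A.hyperplanes} {ψ : Module.Dual K H₀}
    (hψ : LinearMap.ker ψ ∈ (A.restriction H₀ h₀).hyperplanes) :
    ∃ φ : Module.Dual K V, LinearMap.ker φ ∈ A.hyperplanes ∧ φ ∘ₗ H₀.subtype = ψ := by
  have hψ0 := ne_zero_of_isCoatom_ker ((A.restriction H₀ h₀).isCoatom _ hψ)
  obtain ⟨H, hH, hHψ⟩ := hψ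
  obtain ⟨β, hβ⟩ := exists_ker_eq_of_isCoatom (A.isCoatom H hH.1)
  obtain ⟨c, hc⟩ : ∃ c : K, ψ = c • (β ∘ₗ H₀.subtype) := by
    refine exists_smul_of_ker_le_ker ?_
    rw [← hHψ, LinearMap.ker_comp, hβ]
  have hc0 : c ≠ 0 := by
    rintro rfl
    exact hψ0 (by rw [hc, zero_smul])
  exact ⟨c • β, by rw [LinearMap.ker_smul _ _ hc0, hβ]; exact hH.1, hc.symm⟩

/-- A circuit on `H₀` lifts to forms on V whose relation holds up to a multiple of the form of `H₀`.
It becomes a circuit of `A` of the same size, or of size one larger. -/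
theorem HasSmallCircuits.restriction {A : CentralArrangement K V} (hA : A.HasSmallCircuits)
    (H₀ : Submodule K V) (h₀ : H₀ ∈ A.hyperplanes) : (A.restriction H₀ h₀).HasSmallCircuits := by
  intro n x a hx hxA hA' ha
  obtain ⟨α, hα⟩ := exists_ker_eq_of_isCoatom (A.isCoatom H₀ h₀)
  have hα0 : α ≠ 0 := ne_zero_of_isCoatom_ker (by rw [hα]; exact A.isCoatom H₀ h₀)
  have hαres : α ∘ₗ H₀.subtype = 0 := by
    ext v
    have : (v : V) ∈ LinearMap.ker α := hα ▸ v.2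
    simpa using this
  choose y hyA hy using fun i => exists_lift_of_ker_mem_restriction (hxA i)
  obtain ⟨φ, hφA, hφ⟩ := exists_lift_of_ker_mem_restriction hA'
  let ρ : Module.Dual K V →ₗ[K] Module.Dual K H₀ := H₀.subtype.dualMap
  have hρ : ∀ i, ρ (y i) = x i := hy
  have hρα : ρ α = 0 := hαres
  obtain ⟨c, hc⟩ : ∃ c : K, φ - ∑ i, a i • y i = c • α := by
    refine exists_smul_of_ker_le_ker fun v hv => ?_
    rw [hα] at hv
    have : ρ (φ - ∑ i, a i • y i) = 0 := by
      rw [map_sub, map_sum]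
      simp only [map_smul, hρ]
      exact sub_eq_zero.2 hφ
    exact DFunLike.congr_fun this ⟨v, hv⟩
  have hyli : LinearIndependent K y := LinearIndependent.of_comp ρ (by
    have : ρ ∘ y = x := funext hρ
    rwa [this])
  rw [sub_eq_iff_eq_add] at hc
  by_cases hc0 : c = 0
  · rw [hc0, zero_smul, zero_add] at hc
    exact hA n y a hyli hyA (hc ▸ hφA) ha
  · have := hA (n + 1) (Fin.cons α y) (Fin.cons c a) ?_ ?_ ?_ ?_
    · omega
    · rw [Fintype.linearIndependent_iff] at hx ⊢
      intro g hg
      rw [Fin.sum_univ_succ] at hg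
      simp only [Fin.cons_zero, Fin.cons_succ] at hg
      have hg' := congrArg ρ hg
      rw [map_add, map_smul, hρα, smul_zero, zero_add, map_sum, map_zero] at hg'
      simp only [map_smul, hρ] at hg'
      have hsucc := hx _ hg'
      simp only [hsucc, zero_smul, Finset.sum_const_zero, add_zero, smul_eq_zero, hα0,
        or_false] at hg
      exact Fin.cases hg hsucc
    · exact Fin.cases (by rw [Fin.cons_zero, hα]; exact h₀) hyA
    · rw [Fin.sum_univ_succ]
      simpa only [Fin.cons_zero, Fin.cons_succ, ← hc] using hφA
    · exact Fin.cases hc0 ha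

/-- Coordinates in which an arrangement with small circuits is given by forms involving at most two
matched variables. -/
theorem HasSmallCircuits.exists_matching [FiniteDimensional K V] {A : CentralArrangement K V}
    (hA : A.HasSmallCircuits) : ∃ (n : ℕ) (B : Module.Basis (Fin n) K (Module.Dual K V))
      (α : A.hyperplanes → Module.Dual K V) (σ : Fin n → Fin n) (i : A.hyperplanes → Fin n)
      (c : A.hyperplanes → K), (∀ H, LinearMap.ker (α H) = H.1) ∧ (∀ j, σ (σ j) = j) ∧
      (∀ H, σ (i H) = i H → c H = 0) ∧
      ∀ H j, B.repr (α H) j = (Pi.single (i H) 1 + Pi.single (σ (i H)) (c H) : Fin n → K) j := by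
  classical
  choose α hα using fun H : A.hyperplanes => exists_ker_eq_of_isCoatom (A.isCoatom H.1 H.2)
  have hα0 : ∀ H, α H ≠ 0 := fun H =>
    ne_zero_of_isCoatom_ker (by rw [hα]; exact A.isCoatom H.1 H.2)
  obtain ⟨κ, k, -, hspan, hli⟩ := exists_linearIndependent' K α
  let B₀ := Module.Basis.sumExtend hli
  have hfin := Module.Finite.finite_basis B₀
  obtain ⟨n, ⟨e⟩⟩ := Finite.exists_equiv_fin (κ ⊕ Module.Basis.sumExtendIndex hli)
  let B := B₀.reindex e
  -- The chosen independent forms already span all `α H`, so the vectors added to complete the basis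
  -- never occur in their expansions.
  have hmemB : ∀ H i, B.repr (α H) i ≠ 0 → ∃ H', B i = α H' := by
    intro H i hi
    have h1 : α H ∈ Submodule.span K (B '' Set.range (e ∘ Sum.inl)) := by
      have : B '' Set.range (e ∘ Sum.inl) = Set.range (α ∘ k) := by
        rw [← Set.range_comp]
        congr 1
        ext1 j
        simp only [Function.comp_apply, B, Module.Basis.reindex_apply, Equiv.symm_apply_apply]
        exact Module.Basis.sumExtend_inl hli j
      rw [this, hspan]
      exact Submodule.subset_span ⟨H, rfl⟩
    obtain ⟨j, rfl⟩ := B.mem_span_image.1 h1 (Finsupp.mem_support_iff.2 hi)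
    refine ⟨k j, ?_⟩
    simp only [Function.comp_apply, B, Module.Basis.reindex_apply, Equiv.symm_apply_apply]
    exact Module.Basis.sumExtend_inl hli j
  have hker : ∀ H i, B.repr (α H) i ≠ 0 → LinearMap.ker (B i) ∈ A.hyperplanes := by
    intro H i hi
    obtain ⟨H', h⟩ := hmemB H i hi
    rw [h, hα]
    exact H'.2
  have htwo : ∀ H i j l, i ≠ j → B.repr (α H) i ≠ 0 → B.repr (α H) j ≠ 0 → l ≠ i → l ≠ j →
      B.repr (α H) l = 0 := by
    intro H i j l hij hi hj hli hlj
    by_contra hl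
    have hcard := hA.card_le_two (τ := (B.repr (α H)).support) (fun s => B s)
      (fun s => B.repr (α H) s) (B.linearIndependent.comp _ Subtype.val_injective)
      (fun s => hker H s (Finsupp.mem_support_iff.1 s.2)) ?_
      (fun s => Finsupp.mem_support_iff.1 s.2)
    · rw [Fintype.card_coe] at hcard
      have hsub : ({i, j, l} : Finset (Fin n)) ⊆ (B.repr (α H)).support := by
        intro s hs
        simp only [Finset.mem_insert, Finset.mem_singleton] at hs
        rw [Finsupp.mem_support_iff]
        rcases hs with rfl | rfl | rfl <;> assumption
      have := Finset.card_le_card hsub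
      rw [Finset.card_eq_three.2 ⟨i, j, l, hij, hli.symm, hlj.symm, rfl⟩] at this
      omega
    · have : ∑ s : (B.repr (α H)).support, B.repr (α H) s • B s = α H := by
        rw [Finset.sum_coe_sort (B.repr (α H)).support fun s => B.repr (α H) s • B s]
        exact B.linearCombination_repr (α H)
      rw [this, hα]
      exact H.2
  have hexp : ∀ H i j, i ≠ j → B.repr (α H) i ≠ 0 → B.repr (α H) j ≠ 0 →
      α H = B.repr (α H) i • B i + B.repr (α H) j • B j := by
    intro H i j hij hi hj
    conv_lhs => rw [← B.sum_repr (α H)]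
    rw [← Finset.sum_pair (f := fun l => B.repr (α H) l • B l) hij]
    refine (Finset.sum_subset (Finset.subset_univ _) fun l _ hl => ?_).symm
    simp only [Finset.mem_insert, Finset.mem_singleton, not_or] at hl
    rw [htwo H i j l hij hi hj hl.1 hl.2, zero_smul]
  -- Graph joining two coordinates that occur together in some form. It is a matching, and σ
  -- exchanges the ends of each edge.
  let E : Fin n → Fin n → Prop := fun i j =>
    i ≠ j ∧ ∃ H, B.repr (α H) i ≠ 0 ∧ B.repr (α H) j ≠ 0
  have hEsymm : ∀ i j, E i j → E j i := fun i j ⟨hij, H, h₁, h₂⟩ => ⟨hij.symm, H, h₂, h₁⟩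
  have hE : ∀ i j l, E i j → E j l → i = l := by
    rintro i j l ⟨hij, H, hi, hj⟩ ⟨hjl, H', hj', hl'⟩
    by_contra hil
    have h1 := hexp H i j hij hi hj
    have h2 := hexp H' j l hjl hj' hl'
    set a := B.repr (α H) i
    set b := B.repr (α H) j
    set c := B.repr (α H') j
    set d := B.repr (α H') l
    -- Two edges meeting at `j` give α H = a B_i + b B_j and α H' = c B_j + d B_l. Eliminating B_j
    -- writes α H' with nonzero coefficients in three independent forms.
    have := hA 3 ![α H, B i, B l] ![c / b, - (c / b * a), d] ?_ ?_ ?_ ?_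
    · omega
    · rw [Fintype.linearIndependent_iff]
      intro g hg
      rw [Fin.sum_univ_three] at hg
      simp only [Matrix.cons_val_zero, Matrix.cons_val_one, Matrix.cons_val_two,
        Matrix.tail_cons, Matrix.head_cons] at hg
      have hcoord : ∀ s, g 0 * B.repr (α H) s + g 1 * B.repr (B i) s + g 2 * B.repr (B l) s = 0 :=
        fun s => by
          have := congrArg (fun v => B.repr v s) hg
          simpa only [map_add, map_smul, Finsupp.add_apply, Finsupp.smul_apply, smul_eq_mul,
            map_zero, Finsupp.zero_apply] using this
      have hb : B.repr (α H) j ≠ 0 := hj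
      have g0 : g 0 = 0 := by
        have := hcoord j
        simpa [Finsupp.single_apply, hij, Ne.symm hjl, hb] using this
      have g1 : g 1 = 0 := by
        have := hcoord i
        simpa [Finsupp.single_apply, g0, Ne.symm hil] using this
      have g2 : g 2 = 0 := by
        have := hcoord l
        simpa [Finsupp.single_apply, g0, g1] using this
      intro s
      fin_cases s
      exacts [g0, g1, g2]
    · intro s
      fin_cases s
      · exact (hα H).symm ▸ H.2
      · exact hker H i hi
      · exact hker H' l hl'
    · have : ∑ s, (![c / b, - (c / b * a), d] : Fin 3 → K) s • ![α H, B i, B l] s = α H' := by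
        rw [Fin.sum_univ_three]
        simp only [Matrix.cons_val_zero, Matrix.cons_val_one, Matrix.cons_val_two,
          Matrix.tail_cons, Matrix.head_cons]
        rw [h1, h2, smul_add, smul_smul, smul_smul, div_mul_cancel₀ _ hj]
        module
      rw [this, hα]
      exact H'.2
    · intro s
      fin_cases s
      · exact div_ne_zero hj' hj
      · exact neg_ne_zero.2 (mul_ne_zero (div_ne_zero hj' hj) hi)
      · exact hl'
  let σ : Fin n → Fin n := fun i => if h : ∃ j, E i j then h.choose else i
  have hσE : ∀ i j, E i j → σ i = j := by
    intro i j hij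
    have hex : ∃ j, E i j := ⟨j, hij⟩
    simp only [σ, dif_pos hex]
    exact (hE j i _ (hEsymm i j hij) hex.choose_spec).symm
  have hσ : ∀ i, σ (σ i) = i := by
    intro i
    by_cases hex : ∃ j, E i j
    · obtain ⟨j, hj⟩ := hex
      rw [hσE i j hj, hσE j i (hEsymm i j hj)]
    · have : σ i = i := by simp only [σ, dif_neg hex]
      rw [this, this]
  have hsupp : ∀ H, ∃ i, B.repr (α H) i ≠ 0 := by
    intro H
    by_contra! hcon
    exact hα0 H (B.repr.map_eq_zero_iff.1 (Finsupp.ext hcon))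
  choose i hi using hsupp
  -- Each form is scaled to have coefficient 1 at `i H`. At a fixed point of σ the second
  -- coefficient is set to 0, so that this coordinate is not counted twice.
  refine ⟨n, B, fun H => (B.repr (α H) (i H))⁻¹ • α H, σ, i,
    fun H => if σ (i H) = i H then 0 else (B.repr (α H) (i H))⁻¹ * B.repr (α H) (σ (i H)),
    fun H => ?_, hσ, fun H h => if_pos h, fun H j => ?_⟩
  · rw [LinearMap.ker_smul _ _ (inv_ne_zero (hi H)), hα]
  · rw [map_smul, Finsupp.smul_apply, smul_eq_mul, Pi.add_apply]
    by_cases hji : j = i H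
    · subst hji
      rw [Pi.single_eq_same, inv_mul_cancel₀ (hi H)]
      by_cases h : σ (i H) = i H
      · simp [h]
      · rw [Pi.single_eq_of_ne (Ne.symm h), add_zero]
    · rw [Pi.single_eq_of_ne hji, zero_add]
      by_cases hjσ : j = σ (i H)
      · dsimp only
        rw [← hjσ, Pi.single_eq_same, if_neg hji]
      · rw [Pi.single_eq_of_ne hjσ]
        have : B.repr (α H) j = 0 := by
          by_contra hj
          exact hjσ (hσE (i H) j ⟨Ne.symm hji, H, hi H, hj⟩).symm
        rw [this, mul_zero]

theorem HasSmallCircuits.isTotallyFree [FiniteDimensional K V] {A : CentralArrangement K V}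
    (hA : A.HasSmallCircuits) : A.IsTotallyFree := by
  intro m
  obtain ⟨n, B, α, σ, i, c, hα, hσ, hc, hB⟩ := hA.exists_matching
  have := A.finite.fintype
  rw [IsFreeMultiplicity, free_logDer_iff B hα m]
  have heq : (fun H j => B.repr (α H) j) =
      fun H => (Pi.single (i H) 1 + Pi.single (σ (i H)) (c H) : Fin n → K) :=
    funext fun H => funext fun j => hB H j
  rw [heq]
  exact free_polyLogDer_of_matching hσ i c hc _

/-- Totally free arrangements contain no circuits of more than three forms. -/
theorem IsTotallyFree.hasSmallCircuits [FiniteDimensional K V] {A : CentralArrangement K V}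
    (hA : A.IsTotallyFree) : A.HasSmallCircuits := by
  classical
  intro n x a hx hxA hφA ha
  by_contra! hn
  set φ := ∑ i, a i • x i with hφ
  let B₀ := Module.Basis.sumExtend hx
  have hfin := Module.Finite.finite_basis B₀
  have := Fintype.ofFinite (Fin n ⊕ Module.Basis.sumExtendIndex hx)
  have hB₀ : ∀ i, B₀ (.inl i) = x i := Module.Basis.sumExtend_inl hx
  have hrx : ∀ i, B₀.repr (x i) = Finsupp.single (.inl i) 1 := fun i => by
    rw [← hB₀, B₀.repr_self]
  have hrφ : B₀.repr φ = ∑ i, Finsupp.single (.inl i) (a i) := by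
    simp [hφ, map_sum, hrx]
  have hrφl : ∀ i, B₀.repr φ (.inl i) = a i := fun i => by
    simp [hrφ, Finsupp.finsetSum_apply, Finsupp.single_apply]
  have hrφr : ∀ j, B₀.repr φ (.inr j) = 0 := fun j => by
    simp [hrφ, Finsupp.finsetSum_apply]
  have hxφ : ∀ i, LinearMap.ker (x i) ≠ LinearMap.ker φ := by
    intro i h
    obtain ⟨c, hc⟩ := exists_smul_of_ker_le_ker h.le
    obtain ⟨j, hj⟩ : ∃ j, j ≠ i := by
      have : Nontrivial (Fin n) := Fin.nontrivial_iff_two_le.2 (by omega)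
      exact exists_ne i
    have h1 := congrArg (fun v => B₀.repr v (.inl j)) hc
    simp only [hrφl, map_smul, hrx, Finsupp.smul_apply, Finsupp.single_apply] at h1
    simp [Ne.symm hj, ha j] at h1
  have hxx : ∀ i j, LinearMap.ker (x i) = LinearMap.ker (x j) → i = j := by
    intro i j h
    by_contra hij
    obtain ⟨c, hc⟩ := exists_smul_of_ker_le_ker h.le
    have h1 := congrArg (fun v => B₀.repr v (.inl j)) hc
    simp only [map_smul, hrx, Finsupp.smul_apply, Finsupp.single_apply] at h1
    simp [hij] at h1
  -- The defining forms are chosen to be exactly the xᵢ and φ on the circuit, so that they have the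
  -- coordinates required by `not_free_of_circuit`.
  have hex : ∀ H : A.hyperplanes, ∃ ψ : Module.Dual K V, LinearMap.ker ψ = H.1 ∧
      (∀ i, LinearMap.ker (x i) = H.1 → ψ = x i) ∧ (LinearMap.ker φ = H.1 → ψ = φ) := by
    intro H
    by_cases h1 : ∃ i, LinearMap.ker (x i) = H.1
    · obtain ⟨i, hi⟩ := h1
      refine ⟨x i, hi, fun j hj => ?_, fun h => absurd (hi.trans h.symm) (hxφ i)⟩
      rw [hxx i j (hi.trans hj.symm)]
    · by_cases h2 : LinearMap.ker φ = H.1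
      · exact ⟨φ, h2, fun i hi => absurd ⟨i, hi⟩ h1, fun _ => rfl⟩
      · obtain ⟨ψ, hψ⟩ := exists_ker_eq_of_isCoatom (A.isCoatom H.1 H.2)
        exact ⟨ψ, hψ, fun i hi => absurd ⟨i, hi⟩ h1, fun h => absurd h h2⟩
  choose α hα hαx hαφ using hex
  have hα0 : ∀ H, α H ≠ 0 := fun H =>
    ne_zero_of_isCoatom_ker (by rw [hα]; exact A.isCoatom H.1 H.2)
  have := A.finite.fintype
  let Hx : Fin n → A.hyperplanes := fun i => ⟨_, hxA i⟩
  let h₀ : A.hyperplanes := ⟨_, hφA⟩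
  let r := Fintype.card A.hyperplanes
  -- After the successor: n(r + 1) + r + 1 on φ, N = r + 1 on each xᵢ, and 1 elsewhere. As r is the
  -- number of hyperplanes, the rest contributes at most r.
  let m : A.hyperplanes → ℕ+ := fun H => Nat.succPNat
    ((if H = h₀ then n * (r + 1) + r else 0) + ∑ i, if H = Hx i then r else 0)
  have hHx : ∀ i j, Hx i = Hx j ↔ i = j := fun i j =>
    ⟨fun h => hxx i j (congrArg Subtype.val h), fun h => by rw [h]⟩
  have hHx₀ : ∀ i, Hx i ≠ h₀ := fun i h => hxφ i (congrArg Subtype.val h)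
  have hfree := (free_logDer_iff B₀ hα m).1 (hA m)
  have ha0 : ∀ H, (fun j => B₀.repr (α H) j) ≠ 0 := fun H h =>
    hα0 H (B₀.repr.map_eq_zero_iff.1 (Finsupp.ext (congrFun h)))
  refine not_free_of_circuit (N := r + 1) (k := n * (r + 1) + r + 1) (r := r) ha0 ?_
    (Finset.univ.map ⟨Sum.inl, Sum.inl_injective⟩) ?_ (Sum.elim Hx fun _ => h₀) ?_ h₀ ?_ ?_ ?_ ?_
    (Nat.lt_succ_self r) ?_ hfree
  · intro H H' hdvd
    obtain ⟨c, hc⟩ := linPoly_dvd_linPoly (ha0 H) hdvd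
    have hc' : α H' = c • α H := by
      refine B₀.repr.injective (Finsupp.ext fun j => ?_)
      rw [map_smul]
      exact congrFun hc j
    have hc0 : c ≠ 0 := by
      rintro rfl
      exact hα0 H' (by rw [hc', zero_smul])
    refine Subtype.ext ?_
    rw [← hα H, ← hα H', hc', LinearMap.ker_smul _ _ hc0]
  · rw [Finset.card_map, Finset.card_univ, Fintype.card_fin]
    exact hn
  · intro j hj
    obtain ⟨i, -, rfl⟩ := Finset.mem_map.1 hj
    ext l
    simp only [Function.Embedding.coeFn_mk, Sum.elim_inl]
    rw [hαx (Hx i) i rfl, hrx, Finsupp.single_apply, Pi.single_apply]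
    simp only [eq_comm]
  · intro j
    rw [hαφ h₀ rfl]
    rcases j with j | j
    · simp [hrφl, ha]
    · simp [hrφr]
  · intro j hj
    obtain ⟨i, -, rfl⟩ := Finset.mem_map.1 hj
    simp [m, hHx, hHx₀]
  · simp [m, Ne.symm (hHx₀ _)]
  · have hsum : ∑ H, (m H : ℕ) = (n * (r + 1) + r) + n * r + r := by
      simp only [m, Nat.succPNat_coe, Nat.succ_eq_add_one, Finset.sum_add_distrib]
      rw [Finset.sum_comm]
      simp [r]
    rw [hsum, Finset.card_map, Finset.card_univ, Fintype.card_fin]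
    have : n * r ≤ n * (r + 1) := Nat.mul_le_mul_left _ (Nat.le_succ r)
    omega
  · rw [Finset.card_map, Finset.card_univ, Fintype.card_fin]
    omega

end

end CentralArrangement

theorem mainTheorem5 {K V : Type*} [Field K] [AddCommGroup V] [Module K V]
    [FiniteDimensional K V] (A : CentralArrangement K V) (hA : A.IsTotallyFree) :
    (∀ B : CentralArrangement K V, B.IsSubarrangement A → B.IsTotallyFree) ∧
    (∀ (H₀ : Submodule K V) (h₀ : H₀ ∈ A.hyperplanes), (A.restriction H₀ h₀).IsTotallyFree) :=
  ⟨fun _ hB => (hA.hasSmallCircuits.of_isSubarrangement hB).isTotallyFree,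
    fun H₀ h₀ => (hA.hasSmallCircuits.restriction H₀ h₀).isTotallyFree⟩
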